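/- Let $F$ be a field of characteristic zero, let $L$ be a Lie algebra over $F$ with universal enveloping algebra $U(L)$, and fix a basis $(h_i)_{i\in I}$ of $U(L)$. An $L$-algebra is an associative $F$-algebra $A$ (not necessarily unital) on which $L$ acts by derivations; the action extends to $U(L)$. Let $F\langle X|L\rangle$ be the free associative algebra (without constant terms) on the generators $x_j^{h_i}$, where $j$ ranges over a countable set and $i\in I$; write $x_j^h$ for the linear extension to $h\in U(L)$, and $x_j=x_j^1$. It is an $L$-algebra, $\gamma\in L$ acting as the derivation with $x_j^{h}\mapsto x_j^{\gamma h}$. Let $\mathrm{Id}^L(A)$ be the set of differential identities of $A$, i.e. of those $f\in F\langle X|L\rangle$ that vanish under every substitution $x_j^h\mapsto h(a_j)$, $a_j\in A$. A $T_L$-ideal is a two-sided ideal of $F\langle X|L\rangle$ invariant under $U(L)$ and under all endomorphisms commuting with $U(L)$; $\langle S\rangle_{T_L}$ is the smallest $T_L$-ideal containing $S$. Let $P_n^L$ be the span of the monomials $x_{\sigma(1)}^{h_{i_1}}\cdots x_{\sigma(n)}^{h_{i_n}}$ ($\sigma\in S_n$), on which $S_n$ acts by $\sigma(x_j^h)=x_{\sigma(j)}^h$;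 let $c_n^L(A)$ and $\chi_n^L(A)$ be the dimension and the $S_n$-character of $P_n^L/(P_n^L\cap \mathrm{Id}^L(A))$. Let $\chi_\lambda$ be the irreducible character of $S_n$ associated to a partition $\lambda$ of $n$. Let $M_1=Fe_{22}\oplus Fe_{12}$ and $M_2=Fe_{11}\oplus Fe_{12}$ (with $e_{ij}$ the $2\times 2$ matrix units), with the derivations $\varepsilon(\alpha e_{22}+\beta e_{12})=\beta e_{12}$ of $M_1$ and $\varepsilon(\alpha e_{11}+\beta e_{12})=\beta e_{12}$ of $M_2$. Let $M_k^\varepsilon$ ($k=1,2$) be the $L$-algebra $M_k$ on which $L$ acts through a Lie algebra homomorphism $L\to \mathrm{Der}(M_k)$ with image $F\varepsilon$; write $\varepsilon$ also for any element of $L$ that acts as $\varepsilon$. Then: 1. If the action is faithful (so that $L$ is the one-dimensional Lie algebra spanned by $\varepsilon$), then $$\mathrm{Id}^L(M_1^\varepsilon)=\langle xy^{\varepsilon},\ x^\varepsilon y-y^\varepsilon x-[x,y],\ x^{\varepsilon^2}-x^\varepsilon\rangle_{T_L},$$ $$\mathrm{Id}^L(M_2^\varepsilon)=\langle x^{\varepsilon}y,\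 xy^\varepsilon-yx^\varepsilon-[x,y],\ x^{\varepsilon^2}-x^\varepsilon\rangle_{T_L}.$$ In general, the same equalities hold when the polynomials $x^\gamma$, for all $\gamma\in L$ acting as zero, are added to the generators. 2. $c_n^L(M_1^\varepsilon)=c_n^L(M_2^\varepsilon)=n+1$ for all $n\ge 1$. 3. $\chi_n^L(M_1^\varepsilon)=\chi_n^L(M_2^\varepsilon)=2\chi_{(n)}+\chi_{(n-1,1)}$ for all $n\ge 2$, and $\chi_1^L(M_1^\varepsilon)=\chi_1^L(M_2^\varepsilon)=2\chi_{(1)}$. -/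

import Mathlib

open Module

attribute [local instance] LieRing.ofAssociativeRing

noncomputable section

namespace DiffId

/-! ### Derivations and algebras with derivations -/

/-- The Lie algebra `Der(A)` of all derivations of a (not necessarily unital) associative
`F`-algebra `A`, as a Lie subalgebra of `End_F(A)` with the commutator bracket. -/
def Der (F A : Type*) [Field F] [NonUnitalRing A] [Module F A] [IsScalarTower F A A]
    [SMulCommClass F A A] : LieSubalgebra F (Module.End F A) where
  carrier := {d | ∀ a b : A, d (a * b) = d a * b + a * d b}
  add_mem' {d d'} hd hd' a b := by
    simp only [LinearMap.add_apply, hd a b, hd' a b, add_mul, mul_add]; abel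
  zero_mem' a b := by simp
  smul_mem' c d hd a b := by
    simp only [LinearMap.smul_apply, hd a b, smul_add, smul_mul_assoc, mul_smul_comm]
  lie_mem' {d d'} hd hd' a b := by
    have h1 : ∀ a b : A, d (a * b) = d a * b + a * d b := hd
    have h2 : ∀ a b : A, d' (a * b) = d' a * b + a * d' b := hd'
    simp only [LieRing.of_associative_ring_bracket, LinearMap.sub_apply, Module.End.mul_apply,
      h1, h2, map_add, sub_mul, mul_sub]
    abel

section Action

variable {F L A : Type*} [Field F] [LieRing L] [LieAlgebra F L] [NonUnitalRing A] [Module F A]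
  [IsScalarTower F A A] [SMulCommClass F A A]

/-- An `L`-algebra is an algebra `A` with a Lie algebra homomorphism `ρ : L → Der(A)`; this is the
extension of the action to the universal enveloping algebra `U(L)`. -/
def uAct (ρ : L →ₗ⁅F⁆ Der F A) : UniversalEnvelopingAlgebra F L →ₐ[F] Module.End F A :=
  UniversalEnvelopingAlgebra.lift F ((Der F A).incl.comp ρ)

end Action

/-! ### Derivations of a free associative algebra -/

section FreeDerivation

variable {F α : Type*} [Field F]

/-- The value on the word `a w` of the derivation with prescribed values `δ` on the generators. -/
def wordDer (δ : α → MonoidAlgebra F (FreeSemigroup α)) :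
    α → List α → MonoidAlgebra F (FreeSemigroup α)
  | a, [] => δ a
  | a, c :: w => δ a * MonoidAlgebra.single ⟨c, w⟩ 1
      + MonoidAlgebra.single (FreeSemigroup.of a) 1 * wordDer δ c w

/-- The linear map which is the derivation of the free algebra with prescribed values `δ` on the
generators. -/
def freeDerLin (δ : α → MonoidAlgebra F (FreeSemigroup α)) :
    Module.End F (MonoidAlgebra F (FreeSemigroup α)) :=
  (Finsupp.linearCombination F (fun w : FreeSemigroup α => wordDer δ w.head w.tail)) ∘ₗ
    (MonoidAlgebra.coeffLinearEquiv F).toLinearMap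

theorem freeDerLin_single (δ : α → MonoidAlgebra F (FreeSemigroup α)) (w : FreeSemigroup α)
    (c : F) : freeDerLin δ (MonoidAlgebra.single w c) = c • wordDer δ w.head w.tail := by
  simp [freeDerLin]

theorem wordDer_mul (δ : α → MonoidAlgebra F (FreeSemigroup α)) (c : α) (v : List α) :
    ∀ (u : List α) (a : α), wordDer δ a (u ++ c :: v) =
      wordDer δ a u * MonoidAlgebra.single ⟨c, v⟩ 1
        + MonoidAlgebra.single ⟨a, u⟩ 1 * wordDer δ c v
  | [], a => rfl
  | d :: u, a => by
    have h1 : (MonoidAlgebra.single (⟨d, u ++ c :: v⟩ : FreeSemigroup α) (1 : F)) =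
        MonoidAlgebra.single ⟨d, u⟩ 1 * MonoidAlgebra.single ⟨c, v⟩ 1 := by
      rw [MonoidAlgebra.single_mul_single, one_mul]; rfl
    have h2 : (MonoidAlgebra.single (⟨a, d :: u⟩ : FreeSemigroup α) (1 : F)) =
        MonoidAlgebra.single (FreeSemigroup.of a) 1 * MonoidAlgebra.single ⟨d, u⟩ 1 := by
      rw [MonoidAlgebra.single_mul_single, one_mul]; rfl
    simp only [List.cons_append, wordDer, wordDer_mul δ c v u d, h1, h2, add_mul, mul_add,
      mul_assoc, add_assoc]

theorem freeDerLin_mul (δ : α → MonoidAlgebra F (FreeSemigroup α))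
    (f g : MonoidAlgebra F (FreeSemigroup α)) :
    freeDerLin δ (f * g) = freeDerLin δ f * g + f * freeDerLin δ g := by
  induction f using MonoidAlgebra.induction_linear with
  | zero => simp
  | add f f' hf hf' => rw [add_mul, map_add, hf, hf', map_add, add_mul, add_mul]; abel
  | single u r =>
    induction g using MonoidAlgebra.induction_linear with
    | zero => simp
    | add g g' hg hg' => rw [mul_add, map_add, hg, hg', map_add, mul_add, mul_add]; abel
    | single v s =>
      have hu : (MonoidAlgebra.single u r : MonoidAlgebra F (FreeSemigroup α)) =
          r • MonoidAlgebra.single u 1 := by simp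
      have hv : (MonoidAlgebra.single v s : MonoidAlgebra F (FreeSemigroup α)) =
          s • MonoidAlgebra.single v 1 := by simp
      rw [MonoidAlgebra.single_mul_single, freeDerLin_single, freeDerLin_single,
        freeDerLin_single, hu, hv, FreeSemigroup.head_mul, FreeSemigroup.tail_mul, wordDer_mul]
      simp only [smul_add, smul_mul_assoc, mul_smul_comm, smul_smul, mul_comm s r]

/-- Two derivations of the free algebra which agree on the generators are equal. -/
theorem der_ext {d d' : Module.End F (MonoidAlgebra F (FreeSemigroup α))}
    (hd : d ∈ Der F (MonoidAlgebra F (FreeSemigroup α)))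
    (hd' : d' ∈ Der F (MonoidAlgebra F (FreeSemigroup α)))
    (h : ∀ a, d (MonoidAlgebra.single (FreeSemigroup.of a) 1) =
      d' (MonoidAlgebra.single (FreeSemigroup.of a) 1)) : d = d' := by
  have key : ∀ w : FreeSemigroup α, d (MonoidAlgebra.single w 1) =
      d' (MonoidAlgebra.single w 1) := by
    intro w
    induction w using FreeSemigroup.recOnMul with
    | ih1 a => exact h a
    | ih2 a w h1 h2 =>
      have hm : (MonoidAlgebra.single (FreeSemigroup.of a * w) (1 : F)) =
          MonoidAlgebra.single (FreeSemigroup.of a) 1 * MonoidAlgebra.single w 1 := by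
        rw [MonoidAlgebra.single_mul_single, one_mul]
      rw [hm, hd, hd', h1, h2]
  refine LinearMap.ext fun f => ?_
  induction f using MonoidAlgebra.induction_linear with
  | zero => simp
  | add f g hf hg => rw [map_add, map_add, hf, hg]
  | single w c =>
    have hw : (MonoidAlgebra.single w c : MonoidAlgebra F (FreeSemigroup α)) =
          c • MonoidAlgebra.single w 1 := by simp
    rw [hw, map_smul, map_smul, key w]

end FreeDerivation

/-! ### Differential polynomials -/

/-- The free associative algebra (without constant terms) `F⟨X|L⟩` on the free generators
`x_j^{h_i}`, `j ∈ ℕ`, `i ∈ I`, where `(h_i)_{i ∈ I}` is a basis of `U(L)`: the semigroup algebra of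
the free semigroup on the letters `(j, i)`. -/
abbrev DiffPoly (F I : Type*) [Field F] : Type _ := MonoidAlgebra F (FreeSemigroup (ℕ × I))

section Polynomials

variable {F L I : Type*} [Field F] [LieRing L] [LieAlgebra F L]
  (b : Basis I F (UniversalEnvelopingAlgebra F L))

/-- `X b j h` is `x_j^h`, for an arbitrary `h ∈ U(L)`: the linear extension in `h` of the free
generators `x_j^{h_i}`. -/
def X (j : ℕ) : UniversalEnvelopingAlgebra F L →ₗ[F] DiffPoly F I :=
  b.constr F fun i => MonoidAlgebra.single (FreeSemigroup.of (j, i)) 1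

theorem X_basis (j : ℕ) (i : I) :
    X b j (b i) = MonoidAlgebra.single (FreeSemigroup.of (j, i)) 1 := by
  simp [X]

/-- `γ ∈ L` acts on `F⟨X|L⟩` as the derivation with `x_j^{h_i} ↦ x_j^{γ h_i}`. -/
def freeDer (γ : L) : Module.End F (DiffPoly F I) :=
  freeDerLin fun p => X b p.1 (UniversalEnvelopingAlgebra.ι F γ * b p.2)

theorem freeDer_X (γ : L) (j : ℕ) (h : UniversalEnvelopingAlgebra F L) :
    freeDer b γ (X b j h) = X b j (UniversalEnvelopingAlgebra.ι F γ * h) := by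
  have : freeDer b γ ∘ₗ X b j =
      X b j ∘ₗ LinearMap.mulLeft F (UniversalEnvelopingAlgebra.ι F γ) := by
    refine b.ext fun i => ?_
    simp only [LinearMap.comp_apply, LinearMap.mulLeft_apply, X_basis]
    rw [freeDer, freeDerLin_single, one_smul]
    rfl
  exact LinearMap.congr_fun this h

theorem freeDer_mem (γ : L) : freeDer b γ ∈ Der F (DiffPoly F I) :=
  freeDerLin_mul _

/-- The `L`-algebra structure of `F⟨X|L⟩`. -/
def freeAct : L →ₗ⁅F⁆ Der F (DiffPoly F I) where
  toFun γ := ⟨freeDer b γ, freeDer_mem b γ⟩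
  map_add' γ γ' := by
    refine Subtype.ext (der_ext (freeDer_mem b _)
      (add_mem (freeDer_mem b γ) (freeDer_mem b γ')) fun p => ?_)
    change freeDer b (γ + γ') _ = (freeDer b γ + freeDer b γ') _
    rw [← X_basis b p.1 p.2, LinearMap.add_apply, freeDer_X, freeDer_X, freeDer_X]
    simp [add_mul]
  map_smul' c γ := by
    refine Subtype.ext (der_ext (freeDer_mem b _)
      ((Der F (DiffPoly F I)).smul_mem c (freeDer_mem b γ)) fun p => ?_)
    change freeDer b (c • γ) _ = (c • freeDer b γ) _
    rw [← X_basis b p.1 p.2, LinearMap.smul_apply, freeDer_X, freeDer_X]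
    simp
  map_lie' {γ γ'} := by
    refine Subtype.ext (der_ext (freeDer_mem b _)
      ((Der F (DiffPoly F I)).lie_mem (freeDer_mem b γ) (freeDer_mem b γ')) fun p => ?_)
    change freeDer b ⁅γ, γ'⁆ _ = ⁅freeDer b γ, freeDer b γ'⁆ _
    rw [← X_basis b p.1 p.2, LieRing.of_associative_ring_bracket, LinearMap.sub_apply,
      Module.End.mul_apply, Module.End.mul_apply, freeDer_X, freeDer_X, freeDer_X, freeDer_X,
      freeDer_X, LieHom.map_lie, LieRing.of_associative_ring_bracket, ← map_sub, sub_mul,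
      mul_assoc, mul_assoc]

/-- A `T_L`-ideal of `F⟨X|L⟩`: a two-sided ideal which is invariant under the action of `U(L)` and
under all endomorphisms of the `L`-algebra `F⟨X|L⟩` (i.e. under all substitutions of differential
polynomials for the variables). -/
structure IsTIdeal (J : Submodule F (DiffPoly F I)) : Prop where
  mul_left : ∀ f ∈ J, ∀ g, g * f ∈ J
  mul_right : ∀ f ∈ J, ∀ g, f * g ∈ J
  act : ∀ f ∈ J, ∀ h, uAct (freeAct b) h f ∈ J
  subst : ∀ f ∈ J, ∀ φ : DiffPoly F I →ₙₐ[F] DiffPoly F I,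
    (∀ h g, φ (uAct (freeAct b) h g) = uAct (freeAct b) h (φ g)) → φ f ∈ J

/-- `⟨S⟩_{T_L}`, the smallest `T_L`-ideal containing `S`. -/
def TSpan (S : Set (DiffPoly F I)) : Submodule F (DiffPoly F I) :=
  sInf {J | IsTIdeal b J ∧ S ⊆ J}

theorem isTIdeal_TSpan (S : Set (DiffPoly F I)) : IsTIdeal b (TSpan b S) where
  mul_left f hf g := Submodule.mem_sInf.2 fun J hJ =>
    hJ.1.mul_left f (Submodule.mem_sInf.1 hf J hJ) g
  mul_right f hf g := Submodule.mem_sInf.2 fun J hJ =>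
    hJ.1.mul_right f (Submodule.mem_sInf.1 hf J hJ) g
  act f hf h := Submodule.mem_sInf.2 fun J hJ =>
    hJ.1.act f (Submodule.mem_sInf.1 hf J hJ) h
  subst f hf φ hφ := Submodule.mem_sInf.2 fun J hJ =>
    hJ.1.subst f (Submodule.mem_sInf.1 hf J hJ) φ hφ

variable {A : Type*} [NonUnitalRing A] [Module F A] [IsScalarTower F A A] [SMulCommClass F A A]
  (ρ : L →ₗ⁅F⁆ Der F A)

/-- Evaluation `f ↦ f(a_0, a_1, …)` in an `L`-algebra: `x_j^h ↦ h(a_j)`. -/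
def evalAt (a : ℕ → A) : DiffPoly F I →ₙₐ[F] A :=
  MonoidAlgebra.liftMagma F (FreeSemigroup.lift fun p : ℕ × I => uAct ρ (b p.2) (a p.1))

/-- `Id^L(A)`, the set of the differential identities of the `L`-algebra `A`. -/
def IdL : Submodule F (DiffPoly F I) where
  carrier := {f | ∀ a : ℕ → A, evalAt b ρ a f = 0}
  add_mem' hf hg a := by rw [map_add, hf a, hg a, add_zero]
  zero_mem' a := map_zero _
  smul_mem' c f hf a := by rw [map_smul, hf a, smul_zero]

/-! ### Codimensions and cocharacters -/

/-- The word `x_{σ(1)}^{h_{i_1}} ⋯ x_{σ(n)}^{h_{i_n}}` in the free semigroup is the one whose list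
of letters is the given list; the `n` variables are numbered from `0` to `n - 1`. -/
def multilinearWords (I : Type*) (n : ℕ) : Set (FreeSemigroup (ℕ × I)) :=
  {w | ∃ (σ : Equiv.Perm (Fin n)) (h : Fin n → I),
    w.head :: w.tail = List.ofFn fun k => ((σ k : ℕ), h k)}

/-- `P_n^L`, the space of the multilinear differential polynomials in the first `n` variables
(for `n ≥ 1`). -/
def multilinear (F I : Type*) [Field F] (n : ℕ) : Submodule F (DiffPoly F I) :=
  Submodule.span F ((fun w => MonoidAlgebra.single w 1) '' multilinearWords I n)

/-- `σ ∈ S_n` as a permutation of the indices of all variables, fixing those from `n` on. -/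
def extPerm (n : ℕ) : Equiv.Perm (Fin n) →* Equiv.Perm ℕ :=
  Equiv.Perm.extendDomainHom Fin.equivSubtype

theorem extPerm_apply (n : ℕ) (σ : Equiv.Perm (Fin n)) (k : Fin n) :
    extPerm n σ (k : ℕ) = (σ k : ℕ) := by
  simpa [extPerm] using Equiv.Perm.extendDomain_apply_image σ (Fin.equivSubtype (n := n)) k

/-- The left action of `S_n` on differential polynomials, `σ(x_j^h) = x_{σ(j)}^h`. -/
def permRep (F I : Type*) [Field F] (n : ℕ) :
    Representation F (Equiv.Perm (Fin n)) (DiffPoly F I) where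
  toFun σ := MonoidAlgebra.mapDomainLinearMap F F
    (FreeSemigroup.map fun p : ℕ × I => (extPerm n σ p.1, p.2))
  map_one' := by
    have h : (FreeSemigroup.map fun p : ℕ × I => (extPerm n 1 p.1, p.2)) =
        MulHom.id (FreeSemigroup (ℕ × I)) :=
      FreeSemigroup.hom_ext (by ext p : 1; simp)
    rw [h]
    refine LinearMap.ext fun f => ?_
    induction f using MonoidAlgebra.induction_linear with
    | zero => simp
    | add f g hf hg => rw [map_add, map_add, hf, hg]
    | single w c => simp
  map_mul' σ τ := by
    have h : (FreeSemigroup.map fun p : ℕ × I => (extPerm n (σ * τ) p.1, p.2)) =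
        (FreeSemigroup.map fun p : ℕ × I => (extPerm n σ p.1, p.2)).comp
          (FreeSemigroup.map fun p : ℕ × I => (extPerm n τ p.1, p.2)) :=
      FreeSemigroup.hom_ext (by ext p : 1; simp)
    rw [h]
    refine LinearMap.ext fun f => ?_
    induction f using MonoidAlgebra.induction_linear with
    | zero => simp
    | add f g hf hg => rw [map_add, map_add, hf, hg]
    | single w c => simp

theorem permRep_single (n : ℕ) (σ : Equiv.Perm (Fin n)) (w : FreeSemigroup (ℕ × I)) (c : F) :
    permRep F I n σ (MonoidAlgebra.single w c) = MonoidAlgebra.single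
      (FreeSemigroup.map (fun p : ℕ × I => (extPerm n σ p.1, p.2)) w) c := by
  simp [permRep]

theorem multilinear_le (n : ℕ) (σ : Equiv.Perm (Fin n)) :
    multilinear F I n ≤ (multilinear F I n).comap (permRep F I n σ) := by
  refine Submodule.span_le.2 ?_
  rintro _ ⟨w, ⟨τ, h, hw⟩, rfl⟩
  refine Submodule.subset_span ⟨_, ⟨σ * τ, h, ?_⟩, (permRep_single n σ w 1).symm⟩
  have hm : ∀ w : FreeSemigroup (ℕ × I),
      (FreeSemigroup.map (fun p : ℕ × I => (extPerm n σ p.1, p.2)) w).head ::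
        (FreeSemigroup.map (fun p : ℕ × I => (extPerm n σ p.1, p.2)) w).tail =
      (w.head :: w.tail).map (fun p : ℕ × I => (extPerm n σ p.1, p.2)) := by
    intro w
    induction w using FreeSemigroup.recOnMul with
    | ih1 a => rfl
    | ih2 a w h1 h2 =>
      simp only [map_mul, FreeSemigroup.head_mul, FreeSemigroup.tail_mul, List.map_cons,
        List.map_append, ← List.cons_append] at h1 h2 ⊢
      rw [h1, h2]
  rw [hm, hw, List.map_ofFn]
  congr 1
  funext k
  simp [extPerm_apply]

theorem evalAt_permRep (n : ℕ) (σ : Equiv.Perm (Fin n)) (a : ℕ → A) (f : DiffPoly F I) :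
    evalAt b ρ a (permRep F I n σ f) = evalAt b ρ (fun j => a (extPerm n σ j)) f := by
  induction f using MonoidAlgebra.induction_linear with
  | zero => simp
  | add f g hf hg => rw [map_add, map_add, map_add, hf, hg]
  | single w c =>
    have h : (FreeSemigroup.lift fun p : ℕ × I => uAct ρ (b p.2) (a p.1)).comp
        (FreeSemigroup.map fun p : ℕ × I => (extPerm n σ p.1, p.2)) =
        FreeSemigroup.lift fun p : ℕ × I => uAct ρ (b p.2) (a (extPerm n σ p.1)) :=
      FreeSemigroup.hom_ext (by ext p : 1; simp)
    rw [permRep_single]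
    simp [evalAt, ← h]

/-- The action of `S_n` on `P_n^L`. -/
def multilinearRep (F I : Type*) [Field F] (n : ℕ) :
    Representation F (Equiv.Perm (Fin n)) (multilinear F I n) :=
  (permRep F I n).subrepresentation (multilinear F I n) (multilinear_le n)

/-- `P_n^L ∩ Id^L(A)`, as a subspace of `P_n^L`. -/
def multilinearId (n : ℕ) : Submodule F (multilinear F I n) :=
  (IdL b ρ).submoduleOf (multilinear F I n)

theorem multilinearId_le (n : ℕ) (σ : Equiv.Perm (Fin n)) :
    multilinearId b ρ n ≤ (multilinearId b ρ n).comap (multilinearRep F I n σ) := by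
  intro f hf a
  exact (evalAt_permRep b ρ n σ a f).trans (hf _)

/-- The `n`th differential codimension
`c_n^L(A) = dim P_n^L(A)`, `P_n^L(A) = P_n^L / (P_n^L ∩ Id^L(A))`. -/
def codim (n : ℕ) : Cardinal :=
  Module.rank F (multilinear F I n ⧸ multilinearId b ρ n)

/-- The `n`th differential cocharacter `χ_n^L(A)`: the character of the `S_n`-module `P_n^L(A)`. -/
def cochar (n : ℕ) : Equiv.Perm (Fin n) → F :=
  ((multilinearRep F I n).quotient (multilinearId b ρ n) (multilinearId_le b ρ n)).character

end Polynomials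

/-! ### Irreducible characters of the symmetric group -/

section Specht

variable (F : Type*) [Field F] {n : ℕ}

/-- The permutation module of `S_n` on all maps `r : {1, …, n} → ℕ`; the map `r` stands for the
tabloid in which the number `k` lies in row `r k`. -/
def tabloidRep (n : ℕ) : Representation F (Equiv.Perm (Fin n)) ((Fin n → ℕ) →₀ F) where
  toFun σ := Finsupp.lmapDomain F F fun r k => r (σ⁻¹ k)
  map_one' := Finsupp.lhom_ext fun r c => by simp
  map_mul' σ τ := Finsupp.lhom_ext fun r c => by simp

/-- The polytabloid of a tableau `T` of shape `μ`; the number `k` lies in the cell `T k`, a pair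
(row, column). The sum runs over the column stabilizer of `T`. -/
def polytabloid {μ : YoungDiagram} (T : Fin n ≃ μ.cells) : (Fin n → ℕ) →₀ F :=
  ∑ τ : Equiv.Perm (Fin n) with ∀ k, (T (τ k)).1.2 = (T k).1.2,
    ((Equiv.Perm.sign τ : ℤ) : F) • Finsupp.single (fun k => (T (τ⁻¹ k)).1.1) 1

/-- The Specht module of shape `μ`, for a Young diagram `μ` with `n` cells: the span of the
polytabloids of all tableaux of shape `μ`. -/
def specht (n : ℕ) (μ : YoungDiagram) : Submodule F ((Fin n → ℕ) →₀ F) :=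
  Submodule.span F (Set.range fun T : Fin n ≃ μ.cells => polytabloid F T)

theorem tabloidRep_polytabloid {μ : YoungDiagram} (T : Fin n ≃ μ.cells)
    (σ : Equiv.Perm (Fin n)) :
    tabloidRep F n σ (polytabloid F T) = polytabloid F (σ⁻¹.trans T) := by
  have h : ∀ τ : Equiv.Perm (Fin n),
      tabloidRep F n σ (((Equiv.Perm.sign τ : ℤ) : F) •
        Finsupp.single (fun k => (T (τ⁻¹ k)).1.1) 1) =
      ((Equiv.Perm.sign (MulAut.conj σ τ) : ℤ) : F) •
        Finsupp.single (fun k => (T (σ⁻¹ ((MulAut.conj σ τ)⁻¹ k))).1.1) 1 := by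
    intro τ
    have hs : Equiv.Perm.sign (MulAut.conj σ τ) = Equiv.Perm.sign τ := by
      rw [MulAut.conj_apply, map_mul, map_mul, mul_comm, ← mul_assoc, ← map_mul, inv_mul_cancel,
        map_one, one_mul]
    rw [hs]
    simp [tabloidRep, MulAut.conj_apply]
  rw [polytabloid, polytabloid, map_sum, Finset.sum_congr rfl fun τ _ => h τ]
  refine Finset.sum_equiv (MulAut.conj σ).toEquiv (fun τ => ?_) (fun τ _ => rfl)
  rw [Finset.mem_filter_univ, Finset.mem_filter_univ]
  refine ⟨fun H k => ?_, fun H k => ?_⟩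
  · simpa [MulAut.conj_apply] using H (σ⁻¹ k)
  · simpa [MulAut.conj_apply] using H (σ k)

theorem specht_le (μ : YoungDiagram) (σ : Equiv.Perm (Fin n)) :
    specht F n μ ≤ (specht F n μ).comap (tabloidRep F n σ) := by
  refine Submodule.span_le.2 ?_
  rintro _ ⟨T, rfl⟩
  exact Submodule.mem_comap.2 (tabloidRep_polytabloid F T σ ▸ Submodule.subset_span ⟨_, rfl⟩)

/-- The irreducible character `χ_μ` of `S_n`, for a Young diagram `μ` with `n` cells. -/
def chi (n : ℕ) (μ : YoungDiagram) : Equiv.Perm (Fin n) → F :=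
  Representation.character (V := specht F n μ)
    ((tabloidRep F n).subrepresentation (specht F n μ) (specht_le F μ))

end Specht

/-- The partition `(n)`. -/
def rowShape (n : ℕ) : YoungDiagram :=
  YoungDiagram.ofRowLens [n] (List.sortedGE_iff_pairwise.2 (by simp))

/-- The partition `(n - 1, 1)` of `n ≥ 2`. -/
def hookShape (n : ℕ) (hn : 2 ≤ n) : YoungDiagram :=
  YoungDiagram.ofRowLens [n - 1, 1] (List.sortedGE_iff_pairwise.2 (by simp; omega))

/-! ### The algebras -/

/-- The algebra `M₁ = F e₂₂ ⊕ F e₁₂` of `2 × 2` matrices. -/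
def M₁ (F : Type*) [Field F] : NonUnitalSubalgebra F (Matrix (Fin 2) (Fin 2) F) where
  carrier := {m | m 0 0 = 0 ∧ m 1 0 = 0}
  add_mem' {m m'} hm hm' := by
    simp only [Set.mem_ofPred_eq, Matrix.add_apply] at *; simp [hm, hm']
  zero_mem' := by simp
  mul_mem' {m m'} hm hm' := by
    simp only [Set.mem_ofPred_eq, Matrix.mul_apply, Fin.sum_univ_two] at *; simp [hm, hm']
  smul_mem' c m hm := by
    simp only [Set.mem_ofPred_eq, Matrix.smul_apply] at *; simp [hm]

/-- The algebra `M₂ = F e₁₁ ⊕ F e₁₂` of `2 × 2` matrices. -/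
def M₂ (F : Type*) [Field F] : NonUnitalSubalgebra F (Matrix (Fin 2) (Fin 2) F) where
  carrier := {m | m 1 0 = 0 ∧ m 1 1 = 0}
  add_mem' {m m'} hm hm' := by
    simp only [Set.mem_ofPred_eq, Matrix.add_apply] at *; simp [hm, hm']
  zero_mem' := by simp
  mul_mem' {m m'} hm hm' := by
    simp only [Set.mem_ofPred_eq, Matrix.mul_apply, Fin.sum_univ_two] at *; simp [hm, hm']
  smul_mem' c m hm := by
    simp only [Set.mem_ofPred_eq, Matrix.smul_apply] at *; simp [hm]

theorem M₁_eq_span (F : Type*) [Field F] : (M₁ F).toSubmodule =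
    Submodule.span F {Matrix.single 1 1 1, Matrix.single 0 1 1} := by
  refine le_antisymm (fun m hm => ?_) (Submodule.span_le.2 ?_)
  · have hm' : m 0 0 = 0 ∧ m 1 0 = 0 := hm
    refine Submodule.mem_span_pair.2 ⟨m 1 1, m 0 1, ?_⟩
    ext i j
    fin_cases i <;> fin_cases j <;> simp [hm']
  · rintro _ (rfl | rfl) <;> exact ⟨by simp, by simp⟩

theorem M₂_eq_span (F : Type*) [Field F] : (M₂ F).toSubmodule =
    Submodule.span F {Matrix.single 0 0 1, Matrix.single 0 1 1} := by
  refine le_antisymm (fun m hm => ?_) (Submodule.span_le.2 ?_)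
  · have hm' : m 1 0 = 0 ∧ m 1 1 = 0 := hm
    refine Submodule.mem_span_pair.2 ⟨m 0 0, m 0 1, ?_⟩
    ext i j
    fin_cases i <;> fin_cases j <;> simp [hm']
  · rintro _ (rfl | rfl) <;> exact ⟨by simp, by simp⟩

/-- The derivation `ε (α e₂₂ + β e₁₂) = β e₁₂` of `M₁`. -/
def ε₁ (F : Type*) [Field F] : Der F (M₁ F) where
  val :=
    { toFun := fun m => ⟨Matrix.single 0 1 (m.1 0 1), by simp, by simp⟩
      map_add' := fun m m' => Subtype.ext (by simp [Matrix.single_add])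
      map_smul' := fun c m => Subtype.ext (by simp) }
  property := by
    rintro ⟨m, h1, h2⟩ ⟨m', h1', h2'⟩
    refine Subtype.ext ?_
    ext i j
    fin_cases i <;> fin_cases j <;>
      simp [Matrix.mul_apply, Fin.sum_univ_two, h1, h2, h1', h2']

/-- The derivation `ε (α e₁₁ + β e₁₂) = β e₁₂` of `M₂`. -/
def ε₂ (F : Type*) [Field F] : Der F (M₂ F) where
  val :=
    { toFun := fun m => ⟨Matrix.single 0 1 (m.1 0 1), by simp, by simp⟩
      map_add' := fun m m' => Subtype.ext (by simp [Matrix.single_add])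
      map_smul' := fun c m => Subtype.ext (by simp) }
  property := by
    rintro ⟨m, h1, h2⟩ ⟨m', h1', h2'⟩
    refine Subtype.ext ?_
    ext i j
    fin_cases i <;> fin_cases j <;>
      simp [Matrix.mul_apply, Fin.sum_univ_two, h1, h2, h1', h2']

/-! ### The generating identities -/

section Generators

variable {F L I : Type*} [Field F] [LieRing L] [LieAlgebra F L]
  (b : Basis I F (UniversalEnvelopingAlgebra F L))

/-- For `e ∈ L`, the polynomials `x y^e`, `x^e y - y^e x - [x, y]` and `x^{e²} - x^e`. -/
def gens₁ (e : L) : Set (DiffPoly F I) :=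
  {X b 0 1 * X b 1 (UniversalEnvelopingAlgebra.ι F e),
    X b 0 (UniversalEnvelopingAlgebra.ι F e) * X b 1 1
      - X b 1 (UniversalEnvelopingAlgebra.ι F e) * X b 0 1
      - (X b 0 1 * X b 1 1 - X b 1 1 * X b 0 1),
    X b 0 (UniversalEnvelopingAlgebra.ι F e ^ 2) - X b 0 (UniversalEnvelopingAlgebra.ι F e)}

/-- For `e ∈ L`, the polynomials `x^e y`, `x y^e - y x^e - [x, y]` and `x^{e²} - x^e`. -/
def gens₂ (e : L) : Set (DiffPoly F I) :=
  {X b 0 (UniversalEnvelopingAlgebra.ι F e) * X b 1 1,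
    X b 0 1 * X b 1 (UniversalEnvelopingAlgebra.ι F e)
      - X b 1 1 * X b 0 (UniversalEnvelopingAlgebra.ι F e)
      - (X b 0 1 * X b 1 1 - X b 1 1 * X b 0 1),
    X b 0 (UniversalEnvelopingAlgebra.ι F e ^ 2) - X b 0 (UniversalEnvelopingAlgebra.ι F e)}

end Generators

end DiffId

end

open DiffId

/-! Both algebras have two linear coordinates: α, the surviving diagonal entry, and β, the
off-diagonal entry. The coordinate α is multiplicative, ε is the projection (α, β) ↦ (0, β), and
β(xy) equals β(x)α(y) in `M₁` and α(x)β(y) in `M₂`. The two algebras are thus mirror images, and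
`IsCoordinates` records what they share.

Identities. Let J be the T-ideal generated by the listed polynomials. Modulo J every x^h is a
combination of x and x^e (`IsTIdeal.X_mem`). For `M₁`, everything multiplied on the right by some
x_j^e lies in J, so words reduce to x_i or x_i^e followed by plain variables. Multiplying the second
generator on the left by f and dropping the two terms already in J gives f[x_i, x_j] ∈ J. Hence the
right multiplications r_j by x_j commute modulo J. The second generator itself says r_i z_j = r_j
z_i for z_j = x_j - x_j^e. The quotient by J is therefore spanned by the products z_j r_{j_1} ⋯
r_{j_k}, symmetric in all indices, and by the products y_j r_{j_1} ⋯ r_{j_k} with y_j = x_j^e. On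
values, α turns the first family into the monomials of degree at least one in the α(a_i) and kills
the second. In turn β kills the first family and turns the second into β(a_j) times such a monomial.
Over an infinite field the values of a polynomial determine its coefficients, so an identity is zero
in the quotient (`eq_zero_of_evaluations`, `IdL_le_of_operators`). For `M₂` left multiplications are
used.

Codimensions and cocharacters. U(L) acts on α and β through weights χ and ψ. A multilinear word
takes values with α a scalar times ∏ α(a_i), and β a scalar times β(a_j) ∏_{i ≠ j} α(a_i), where j
is its first variable (`M₁`) or last variable (`M₂`). So P_n^L modulo identities is F ⊕ F^n, the
trivial module plus the permutation module (`exists_multilinearEquiv`). This gives dimension n + 1.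
In characteristic zero and for n ≥ 2, F^n splits into constant vectors and vectors of sum zero; the
latter form the Specht module of (n - 1, 1) (`specht_hookShape`, `trace_funLeft_eq`). -/

namespace DiffId

/-! ### Modules with commuting operators -/

section CommutingOperators

variable {F Q : Type*} [Field F] [AddCommGroup Q] [Module F Q]

/-- The evaluation of the monomial with the multiset `m` of variables at the point `a`. -/
def monomialEval (a : ℕ → F) (m : Multiset ℕ) : F := (m.map a).prod

theorem monomialEval_cons (a : ℕ → F) (j : ℕ) (m : Multiset ℕ) :
    monomialEval a (j ::ₘ m) = a j * monomialEval a m := by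
  simp [monomialEval]

/-- Over an infinite field, a polynomial with only zero values has zero coefficients. -/
theorem eq_zero_of_linearCombination_monomialEval [Infinite F] (c : Multiset ℕ →₀ F)
    (h : ∀ a : ℕ → F, Finsupp.linearCombination F (monomialEval a) c = 0) : c = 0 := by
  have hli : LinearIndependent F fun m : Multiset ℕ =>
      MvPolynomial.monomial (Multiset.toFinsupp m) (1 : F) := by
    have := (MvPolynomial.basisMonomials ℕ F).linearIndependent.comp
      (Multiset.toFinsupp : Multiset ℕ ≃+ _) (Multiset.toFinsupp.injective)
    simpa [Function.comp_def] using this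
  refine (linearIndependent_iff.1 hli) c (MvPolynomial.funext fun a => ?_)
  have h' := h a
  rw [Finsupp.linearCombination_apply] at h' ⊢
  rw [map_finsuppSum, map_zero, ← h']
  refine Finsupp.sum_congr fun m _ => ?_
  rw [MvPolynomial.smul_eval, MvPolynomial.eval_monomial, one_mul, smul_eq_mul, monomialEval,
    Finset.prod_multiset_map_count]
  simp [Finsupp.prod]

/-- The extension of the operator `r` to `Q × F` which sends `(0, 1)` to `(z, 0)`. -/
def adjoinOp (r : Q →ₗ[F] Q) (z : Q) : Q × F →ₗ[F] Q × F :=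
  (r.comp (LinearMap.fst F Q F) + (LinearMap.toSpanSingleton F Q z).comp
    (LinearMap.snd F Q F)).prod 0

theorem adjoinOp_apply (r : Q →ₗ[F] Q) (z : Q) (p : Q × F) :
    adjoinOp r z p = (r p.1 + p.2 • z, 0) := by
  simp [adjoinOp]

/-- The product of the commuting operators `r j`, `j ∈ m`, applied to `q`. -/
def monomialAct {r : ℕ → Q →ₗ[F] Q} (hr : ∀ i j q, r i (r j q) = r j (r i q)) (q : Q)
    (m : Multiset ℕ) : Q :=
  haveI : LeftCommutative fun j q => r j q := ⟨hr⟩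
  m.foldr (fun j q => r j q) q

theorem monomialAct_zero {r : ℕ → Q →ₗ[F] Q} (hr : ∀ i j q, r i (r j q) = r j (r i q)) (q : Q) :
    monomialAct hr q 0 = q := by
  simp [monomialAct]

theorem monomialAct_cons {r : ℕ → Q →ₗ[F] Q} (hr : ∀ i j q, r i (r j q) = r j (r i q)) (q : Q)
    (j : ℕ) (m : Multiset ℕ) : monomialAct hr q (j ::ₘ m) = r j (monomialAct hr q m) := by
  simp [monomialAct]

/-- A module which is generated by `y j` and `z j` under commuting operators `r j` with
`r i (z j) = r j (z i)` is determined by evaluations of the commutative monomials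
`z_j r_{j_1} ⋯ r_{j_k}` and `y_j r_{j_1} ⋯ r_{j_k}`. -/
theorem eq_zero_of_evaluations [Infinite F] {r : ℕ → Q →ₗ[F] Q} {y z : ℕ → Q}
    (hr : ∀ i j q, r i (r j q) = r j (r i q)) (hz : ∀ i j, r i (z j) = r j (z i))
    (hgen : ∀ V : Submodule F Q, (∀ j, y j ∈ V) → (∀ j, z j ∈ V) →
      (∀ j, ∀ q ∈ V, r j q ∈ V) → V = ⊤)
    (φ ψ : (ℕ → F) → (ℕ → F) → Q →ₗ[F] F)
    (hφr : ∀ a b j q, φ a b (r j q) = a j * φ a b q) (hφz : ∀ a b j, φ a b (z j) = a j)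
    (hφy : ∀ a b j, φ a b (y j) = 0)
    (hψr : ∀ a b j q, ψ a b (r j q) = a j * ψ a b q) (hψz : ∀ a b j, ψ a b (z j) = 0)
    (hψy : ∀ a b j, ψ a b (y j) = b j)
    {q : Q} (hφ : ∀ a b, φ a b q = 0) (hψ : ∀ a b, ψ a b q = 0) : q = 0 := by
  -- Adjoining a formal vector 1 with r_j 1 = z_j keeps the operators commuting, precisely because
  -- r_i z_j = r_j z_i. The products z_j r_{j_1} ⋯ r_{j_k} then become monomials applied to 1, so
  -- they depend only on the multiset of all indices.
  have hs : ∀ i j p, adjoinOp (r i) (z i) (adjoinOp (r j) (z j) p) =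
      adjoinOp (r j) (z j) (adjoinOp (r i) (z i) p) := by
    intro i j p
    simp [adjoinOp_apply, hr i j, hz i j]
  let v : Multiset ℕ → Q × F := monomialAct hs (0, 1)
  have hv0 : v 0 = (0, 1) := monomialAct_zero hs _
  have hv : ∀ j m, v (j ::ₘ m) = (r j (v m).1 + (v m).2 • z j, 0) := fun j m => by
    rw [← adjoinOp_apply]; exact monomialAct_cons hs _ j m
  let w : ℕ → Multiset ℕ → Q := fun j => monomialAct hr (y j)
  have hw0 : ∀ j, w j 0 = y j := fun j => monomialAct_zero hr _
  have hw : ∀ i j m, w i (j ::ₘ m) = r j (w i m) := fun i j m => monomialAct_cons hr _ j m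
  let s : (Multiset ℕ →₀ F) →ₗ[F] Q × F := Finsupp.linearCombination F v
  let t : (ℕ →₀ Multiset ℕ →₀ F) →ₗ[F] Q :=
    Finsupp.lsum F fun j => Finsupp.linearCombination F (w j)
  have hvmem : ∀ m, (v m).1 ∈ LinearMap.range ((LinearMap.fst F Q F).comp s) := fun m =>
    ⟨Finsupp.single m 1, by simp [s]⟩
  have hwmem : ∀ j m, w j m ∈ LinearMap.range t := fun j m =>
    ⟨Finsupp.single j (Finsupp.single m 1), by simp [t]⟩
  have hzv : ∀ j, z j = (v {j}).1 := fun j => by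
    rw [← Multiset.cons_zero, hv, hv0]; simp
  -- The second component of `v m` is nonzero only for the empty monomial. Subtracting its multiple
  -- of z_j corrects for r_j acting on Q alone rather than on the extension.
  have hsr : ∀ {j : ℕ} c, r j ((LinearMap.fst F Q F).comp s c) ∈
      LinearMap.range ((LinearMap.fst F Q F).comp s) := by
    intro j c
    induction c using Finsupp.induction_linear with
    | zero => simp
    | add c c' hc hc' => rw [map_add, map_add]; exact add_mem hc hc'
    | single m k =>
      have : r j (((LinearMap.fst F Q F).comp s) (Finsupp.single m k)) =
          k • ((v (j ::ₘ m)).1 - (v m).2 • (v {j}).1) := by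
        rw [hv, ← hzv]; simp [s]
      rw [this]
      exact Submodule.smul_mem _ _ (sub_mem (hvmem _) (Submodule.smul_mem _ _ (hvmem _)))
  have htr : ∀ {j : ℕ} d, r j (t d) ∈ LinearMap.range t := by
    intro j d
    induction d using Finsupp.induction_linear with
    | zero => simp
    | add d d' hd hd' => rw [map_add, map_add]; exact add_mem hd hd'
    | single i e =>
      induction e using Finsupp.induction_linear with
      | zero => simp
      | add e e' he he' => rw [Finsupp.single_add, map_add, map_add]; exact add_mem he he'
      | single m k =>
        have : r j (t (Finsupp.single i (Finsupp.single m k))) = k • w i (j ::ₘ m) := by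
          rw [hw]; simp [t]
        rw [this]
        exact Submodule.smul_mem _ _ (hwmem _ _)
  have htop : LinearMap.range ((LinearMap.fst F Q F).comp s) ⊔ LinearMap.range t = ⊤ := by
    refine hgen _ (fun j => ?_) (fun j => ?_) fun j q hq => ?_
    · rw [← hw0]; exact Submodule.mem_sup_right (hwmem j 0)
    · rw [hzv]; exact Submodule.mem_sup_left (hvmem _)
    · obtain ⟨_, ⟨c, rfl⟩, _, ⟨d, rfl⟩, rfl⟩ := Submodule.mem_sup.1 hq
      rw [map_add]
      refine add_mem (Submodule.mem_sup_left ?_) (Submodule.mem_sup_right ?_)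
      · exact hsr c
      · exact htr d
  -- The summand `(v m).2` accounts for the empty monomial, whose component in Q is zero although
  -- its evaluation is 1.
  have hφv : ∀ a b m, φ a b (v m).1 + (v m).2 = monomialEval a m := by
    intro a b m
    induction m using Multiset.induction with
    | empty => simp [hv0, monomialEval]
    | cons j m ih => rw [hv, monomialEval_cons, ← ih]; simp [hφr, hφz]; ring
  have hψv : ∀ a b m, ψ a b (v m).1 = 0 := by
    intro a b m
    induction m using Multiset.induction with
    | empty => simp [hv0]
    | cons j m ih => rw [hv]; simp [hψr, hψz, ih]
  have hφw : ∀ a b j m, φ a b (w j m) = 0 := by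
    intro a b j m
    induction m using Multiset.induction with
    | empty => rw [hw0, hφy]
    | cons i m ih => rw [hw, hφr, ih, mul_zero]
  have hψw : ∀ a b j m, ψ a b (w j m) = b j * monomialEval a m := by
    intro a b j m
    induction m using Multiset.induction with
    | empty => rw [hw0, hψy]; simp [monomialEval]
    | cons i m ih => rw [hw, hψr, ih, monomialEval_cons]; ring
  have hφs : ∀ a b c, φ a b (s c).1 =
      Finsupp.linearCombination F (monomialEval a) c - (s c).2 := by
    intro a b c
    have : φ a b ∘ₗ LinearMap.fst F Q F ∘ₗ s =
        Finsupp.linearCombination F (monomialEval a) - LinearMap.snd F Q F ∘ₗ s := by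
      refine Finsupp.lhom_ext fun m k => ?_
      simp [s, ← hφv a b m]; ring
    exact LinearMap.congr_fun this c
  have hψs : ∀ a b c, ψ a b (s c).1 = 0 := by
    intro a b c
    have : ψ a b ∘ₗ LinearMap.fst F Q F ∘ₗ s = 0 := by
      refine Finsupp.lhom_ext fun m k => ?_
      simp [s, hψv]
    exact LinearMap.congr_fun this c
  have hφt : ∀ a b d, φ a b (t d) = 0 := by
    intro a b d
    have : φ a b ∘ₗ t = 0 := by
      refine Finsupp.lhom_ext' fun j => Finsupp.lhom_ext fun m k => ?_
      simp [t, hφw]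
    exact LinearMap.congr_fun this d
  have hψt : ∀ a (b : ℕ → F) d, ψ a b (t d) =
      d.sum fun j e => b j * Finsupp.linearCombination F (monomialEval a) e := by
    intro a b d
    have : ψ a b ∘ₗ t = Finsupp.lsum F fun j =>
        b j • Finsupp.linearCombination F (monomialEval a) := by
      refine Finsupp.lhom_ext' fun j => Finsupp.lhom_ext fun m k => ?_
      simp [t, hψw]; ring
    exact (LinearMap.congr_fun this d).trans (Finsupp.sum_congr fun _ _ => rfl)
  obtain ⟨_, ⟨c, rfl⟩, _, ⟨d, rfl⟩, rfl⟩ := Submodule.mem_sup.1 (htop ▸ Submodule.mem_top (x := q))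
  -- The values of ψ are linear in the second argument, so taking it to be the j-th unit vector
  -- isolates the coefficients of the monomials starting with y_j.
  have hd : d = 0 := by
    ext1 j
    refine eq_zero_of_linearCombination_monomialEval _ fun a => ?_
    have h := hψ a (Pi.single j 1)
    rw [map_add, hψt, LinearMap.comp_apply, LinearMap.fst_apply, hψs, zero_add,
      Finsupp.sum_eq_single j] at h
    · simpa using h
    · intro i _ hi; simp [hi]
    · simp
  -- The constant coefficient of c is invisible to φ, so only the rest of c is forced to vanish.
  -- This suffices, since the formal vector 1 projects to zero in Q.
  have hc : c - Finsupp.single 0 (s c).2 = 0 := by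
    refine eq_zero_of_linearCombination_monomialEval _ fun a => ?_
    have h := hφ a 0
    rw [map_add, hφt, LinearMap.comp_apply, LinearMap.fst_apply, hφs, add_zero] at h
    simpa [monomialEval] using h
  have hsc : s c = (s c).2 • ((0 : Q), (1 : F)) := by
    conv_lhs => rw [sub_eq_zero.1 hc]
    simp only [s, Finsupp.linearCombination_single, hv0]
  rw [hd, map_zero, add_zero, LinearMap.comp_apply, hsc]
  simp

end CommutingOperators

/-! ### Evaluation of differential polynomials -/

section Evaluation

variable {F L I : Type*} [Field F] [LieRing L] [LieAlgebra F L]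

/-- A subspace of `U(L)` which contains `1` and is closed under left multiplication by `L` is
everything. -/
theorem universalEnveloping_eq_top {V : Submodule F (UniversalEnvelopingAlgebra F L)}
    (h1 : 1 ∈ V) (hmul : ∀ γ : L, ∀ h ∈ V, UniversalEnvelopingAlgebra.ι F γ * h ∈ V) :
    V = ⊤ := by
  -- The elements that stabilize V form a subalgebra containing L. By the universal property U(L)
  -- maps into it compatibly with L, and uniqueness makes the composite with the inclusion the
  -- identity, so S is everything. Applying its elements to 1 ∈ V gives the claim.
  let S : Subalgebra F (UniversalEnvelopingAlgebra F L) :=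
    { carrier := {u | ∀ h ∈ V, u * h ∈ V}
      mul_mem' := fun {u u'} hu hu' h hh => by rw [mul_assoc]; exact hu _ (hu' _ hh)
      add_mem' := fun {u u'} hu hu' h hh => by
        rw [add_mul]; exact add_mem (hu _ hh) (hu' _ hh)
      algebraMap_mem' := fun c h hh => by
        rw [← Algebra.smul_def]; exact V.smul_mem c hh }
  let g : L →ₗ⁅F⁆ S :=
    { toFun := fun γ => ⟨UniversalEnvelopingAlgebra.ι F γ, hmul γ⟩
      map_add' := fun γ γ' => Subtype.ext (map_add _ _ _)
      map_smul' := fun c γ => Subtype.ext (map_smul _ _ _)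
      map_lie' := fun {γ γ'} => Subtype.ext (LieHom.map_lie _ _ _) }
  have hid : S.val.comp (UniversalEnvelopingAlgebra.lift F g) = AlgHom.id F _ :=
    UniversalEnvelopingAlgebra.hom_ext F (LieHom.ext fun γ => by
      simp [g])
  refine eq_top_iff.2 fun u _ => ?_
  have hu : u ∈ S := by
    have := (UniversalEnvelopingAlgebra.lift F g u).2
    have h2 := DFunLike.congr_fun hid u
    simp only [AlgHom.comp_apply, AlgHom.id_apply, Subalgebra.coe_val] at h2
    rwa [h2] at this
  simpa using hu 1 h1

variable {A : Type*} [NonUnitalRing A] [Module F A] [IsScalarTower F A A] [SMulCommClass F A A]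
  (b : Basis I F (UniversalEnvelopingAlgebra F L)) (ρ : L →ₗ⁅F⁆ Der F A)

theorem uAct_ι (γ : L) :
    uAct ρ (UniversalEnvelopingAlgebra.ι F γ) = (ρ γ : Module.End F A) := by
  simp [uAct]

theorem uAct_ι_mul (γ : L) (h : UniversalEnvelopingAlgebra F L) (x : A) :
    uAct ρ (UniversalEnvelopingAlgebra.ι F γ * h) x = (ρ γ : Module.End F A) (uAct ρ h x) := by
  rw [map_mul, uAct_ι]; rfl

theorem uAct_freeAct_X (j : ℕ) (h h' : UniversalEnvelopingAlgebra F L) :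
    uAct (freeAct b) h (X b j h') = X b j (h * h') := by
  have hV : (⊤ : Submodule F (UniversalEnvelopingAlgebra F L)) ≤ LinearMap.eqLocus
      ((LinearMap.applyₗ (X b j h')).comp (uAct (freeAct b)).toLinearMap)
      ((X b j).comp (LinearMap.mulRight F h')) := by
    refine (universalEnveloping_eq_top ?_ ?_).ge
    · simp
    · intro γ h hh
      have hh' : uAct (freeAct b) h (X b j h') = X b j (h * h') := hh
      change uAct (freeAct b) (_ * h) (X b j h') = X b j (_ * h * h')
      rw [uAct_ι_mul, hh', mul_assoc]
      exact freeDer_X b γ j _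
  exact hV (Submodule.mem_top (x := h))

theorem evalAt_single (a : ℕ → A) (w : FreeSemigroup (ℕ × I)) (k : F) :
    evalAt b ρ a (MonoidAlgebra.single w k) =
      k • FreeSemigroup.lift (fun p : ℕ × I => uAct ρ (b p.2) (a p.1)) w := by
  simp [evalAt]

theorem evalAt_X (a : ℕ → A) (j : ℕ) (h : UniversalEnvelopingAlgebra F L) :
    evalAt b ρ a (X b j h) = uAct ρ h (a j) := by
  have : (evalAt b ρ a : DiffPoly F I →ₗ[F] A) ∘ₗ X b j =
      (LinearMap.applyₗ (a j)).comp (uAct ρ).toLinearMap := by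
    refine b.ext fun i => ?_
    simp [X_basis, evalAt_single]
  exact LinearMap.congr_fun this h

/-- Non-unital algebra homomorphisms on `F⟨X|L⟩` which agree on the free generators are equal. -/
theorem diffPoly_hom_ext {B : Type*} [NonUnitalRing B] [Module F B] [IsScalarTower F B B]
    [SMulCommClass F B B] {φ ψ : DiffPoly F I →ₙₐ[F] B}
    (h : ∀ j i, φ (X b j (b i)) = ψ (X b j (b i))) : φ = ψ := by
  refine MonoidAlgebra.nonUnitalAlgHom_ext' F (MulHom.ext fun w => ?_)
  induction w using FreeSemigroup.recOnMul with
  | ih1 p => simpa [X_basis] using h p.1 p.2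
  | ih2 p w h1 h2 => rw [map_mul, map_mul, h1, h2]

/-- Evaluation is a homomorphism of `L`-algebras. -/
theorem evalAt_uAct (a : ℕ → A) (h : UniversalEnvelopingAlgebra F L) (f : DiffPoly F I) :
    evalAt b ρ a (uAct (freeAct b) h f) = uAct ρ h (evalAt b ρ a f) := by
  have hγ : ∀ (γ : L) (f : DiffPoly F I),
      evalAt b ρ a (freeDer b γ f) = (ρ γ : Module.End F A) (evalAt b ρ a f) := by
    intro γ f
    have hmul : ∀ x y : A, (ρ γ : Module.End F A) (x * y) =
      (ρ γ : Module.End F A) x * y + x * (ρ γ : Module.End F A) y := (ρ γ).2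
    have hw : ∀ w : FreeSemigroup (ℕ × I),
        evalAt b ρ a (freeDer b γ (MonoidAlgebra.single w 1)) =
        (ρ γ : Module.End F A) (evalAt b ρ a (MonoidAlgebra.single w 1)) := by
      intro w
      induction w using FreeSemigroup.recOnMul with
      | ih1 p =>
        rw [← X_basis b p.1 p.2, freeDer_X, evalAt_X, evalAt_X, uAct_ι_mul]
      | ih2 p w h1 h2 =>
        have hm : (MonoidAlgebra.single (FreeSemigroup.of p * w) (1 : F)) =
            MonoidAlgebra.single (FreeSemigroup.of p) 1 * MonoidAlgebra.single w 1 := by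
          rw [MonoidAlgebra.single_mul_single, one_mul]
        rw [hm, freeDer_mem b γ, map_add, map_mul, map_mul, map_mul, hmul, h1, h2]
    induction f using MonoidAlgebra.induction_linear with
    | zero => simp
    | add f g hf hg => rw [map_add, map_add, map_add, map_add, hf, hg]
    | single w c =>
      have hw' : (MonoidAlgebra.single w c : DiffPoly F I) =
          c • MonoidAlgebra.single w 1 := by simp
      rw [hw', map_smul, map_smul, map_smul, map_smul, hw]
  have hV : (⊤ : Submodule F (UniversalEnvelopingAlgebra F L)) ≤ LinearMap.eqLocus
      ((evalAt b ρ a : DiffPoly F I →ₗ[F] A) ∘ₗ (LinearMap.applyₗ f).comp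
        (uAct (freeAct b)).toLinearMap)
      ((LinearMap.applyₗ (evalAt b ρ a f)).comp (uAct ρ).toLinearMap) := by
    refine (universalEnveloping_eq_top ?_ ?_).ge
    · simp
    · intro γ h hh
      have hh' : evalAt b ρ a (uAct (freeAct b) h f) = uAct ρ h (evalAt b ρ a f) := hh
      change evalAt b ρ a (uAct (freeAct b) (_ * h) f) = uAct ρ (_ * h) (evalAt b ρ a f)
      rw [uAct_ι_mul, uAct_ι_mul, ← hh']
      exact hγ γ _
  exact hV (Submodule.mem_top (x := h))

theorem isTIdeal_IdL : IsTIdeal b (IdL b ρ) where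
  mul_left f hf g a := by rw [map_mul, hf a, mul_zero]
  mul_right f hf g a := by rw [map_mul, hf a, zero_mul]
  act f hf h a := by rw [evalAt_uAct, hf a, map_zero]
  subst f hf φ hφ a := by
    -- An endomorphism commuting with U(L) is fixed by the images of the x_j, so following it by an
    -- evaluation is again an evaluation.
    have : (evalAt b ρ a).comp φ = evalAt b ρ fun j => evalAt b ρ a (φ (X b j 1)) := by
      refine diffPoly_hom_ext b fun j i => ?_
      rw [evalAt_X, NonUnitalAlgHom.comp_apply, ← evalAt_uAct, ← hφ, uAct_freeAct_X, mul_one]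
    exact (DFunLike.congr_fun this f).trans (hf _)

theorem subset_TSpan (S : Set (DiffPoly F I)) : S ⊆ TSpan b S := fun _ hf =>
  Submodule.mem_sInf.2 fun _ hJ => hJ.2 hf

theorem TSpan_le {S : Set (DiffPoly F I)} {J : Submodule F (DiffPoly F I)} (hJ : IsTIdeal b J)
    (hS : S ⊆ J) : TSpan b S ≤ J :=
  sInf_le ⟨hJ, hS⟩

variable {b} in
/-- A `T_L`-ideal is closed under all substitutions. -/
theorem IsTIdeal.evalAt_mem {J : Submodule F (DiffPoly F I)} (hJ : IsTIdeal b J)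
    (g : ℕ → DiffPoly F I) {f : DiffPoly F I} (hf : f ∈ J) : evalAt b (freeAct b) g f ∈ J :=
  hJ.subst f hf _ fun h f => evalAt_uAct b (freeAct b) g h f

end Evaluation

/-! ### The ideals of identities -/

section Identities

variable {F L I : Type*} [Field F] [LieRing L] [LieAlgebra F L]
  {b : Basis I F (UniversalEnvelopingAlgebra F L)}

open UniversalEnvelopingAlgebra (ι)

/-- Modulo a `T_L`-ideal which contains `x^{e²} - x^e` and identifies every `x^γ` with a multiple
of `x^e`, every `x^h` is a linear combination of `x` and `x^e`. -/
theorem IsTIdeal.X_mem {J : Submodule F (DiffPoly F I)} (hJ : IsTIdeal b J) (e : L)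
    (he : X b 0 (ι F e ^ 2) - X b 0 (ι F e) ∈ J)
    (hL : ∀ γ : L, ∃ c : F, X b 0 (ι F γ) - c • X b 0 (ι F e) ∈ J)
    (j : ℕ) (h : UniversalEnvelopingAlgebra F L) :
    X b j h ∈ J ⊔ Submodule.span F {X b j 1, X b j (ι F e)} := by
  set W := J ⊔ Submodule.span F {X b j 1, X b j (ι F e)}
  have hJW : J ≤ W := le_sup_left
  have h1 : X b j 1 ∈ W := Submodule.mem_sup_right (Submodule.subset_span (by simp))
  have h2 : X b j (ι F e) ∈ W := Submodule.mem_sup_right (Submodule.subset_span (by simp))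
  have hsub : ∀ u h' : UniversalEnvelopingAlgebra F L,
      evalAt b (freeAct b) (fun _ => X b j h') (X b 0 u) = X b j (u * h') := fun u h' => by
    rw [evalAt_X, uAct_freeAct_X]
  -- W is stable under L: modulo J, γ sends x_j to c x_j^e, and x_j^e to c x_j^{e²}, hence to c
  -- x_j^e.
  have hact : ∀ γ : L, W ≤ W.comap (uAct (freeAct b) (ι F γ)) := by
    intro γ
    obtain ⟨c, hc⟩ := hL γ
    have hc' : ∀ h', X b j (ι F γ * h') - c • X b j (ι F e * h') ∈ W := fun h' => by
      have := hJ.evalAt_mem (fun _ => X b j h') hc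
      rw [map_sub, map_smul, hsub, hsub] at this
      exact hJW this
    have he' : X b j (ι F e * ι F e) - X b j (ι F e) ∈ W := by
      have := hJ.evalAt_mem (fun _ => X b j 1) he
      rw [map_sub, hsub, hsub, mul_one, mul_one, sq] at this
      exact hJW this
    refine sup_le (fun f hf => hJW (hJ.act f hf _)) (Submodule.span_le.2 ?_)
    rintro _ (rfl | rfl)
    · change uAct (freeAct b) _ _ ∈ W
      rw [uAct_freeAct_X, ← sub_add_cancel (X b j _) (c • X b j (ι F e * 1))]
      refine add_mem (hc' 1) (W.smul_mem _ ?_)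
      rwa [mul_one]
    · change uAct (freeAct b) _ _ ∈ W
      rw [uAct_freeAct_X, ← sub_add_cancel (X b j _) (c • X b j (ι F e * ι F e)),
        ← sub_add_cancel (X b j (ι F e * ι F e)) (X b j (ι F e))]
      exact add_mem (by simpa using hc' (ι F e)) (W.smul_mem _ (add_mem he' h2))
  have : W.comap (X b j) = ⊤ := universalEnveloping_eq_top h1 fun γ h hh => by
    have := hact γ hh
    rw [Submodule.mem_comap, uAct_freeAct_X] at this
    exact this
  exact (this ▸ Submodule.mem_top : h ∈ W.comap (X b j))

variable {A : Type*} [NonUnitalRing A] [Module F A] [IsScalarTower F A A] [SMulCommClass F A A]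

/-- Linear coordinates `α`, `β` on a two-dimensional `L`-algebra such that `α` is multiplicative
and every `γ ∈ L` acts by `(α, β) ↦ (0, c γ β)`. -/
structure IsCoordinates (ρ : L →ₗ⁅F⁆ Der F A) (α β : A →ₗ[F] F) (c : L → F) : Prop where
  eq_zero : ∀ x, α x = 0 → β x = 0 → x = 0
  exists_eq : ∀ s t, ∃ x, α x = s ∧ β x = t
  mul : ∀ x y, α (x * y) = α x * α y
  act_left : ∀ γ x, α ((ρ γ : Module.End F A) x) = 0
  act_right : ∀ γ x, β ((ρ γ : Module.End F A) x) = c γ * β x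

variable {ρ : L →ₗ⁅F⁆ Der F A} {α β : A →ₗ[F] F} {c : L → F}

/-- The common core of both algebras: the operators will be right multiplications by the x_j for
`M₁` and left multiplications for `M₂`. The choice y_j = x_j^e and z_j = x_j - x_j^e separates the
coordinates, because α vanishes on values of x^e while β takes equal values on x and x^e. The
functionals φ and ψ are α and β of the evaluation at the point with prescribed coordinates. -/
theorem IdL_le_of_operators [Infinite F] (H : IsCoordinates ρ α β c) {e : L} (he : c e = 1)
    {J : Submodule F (DiffPoly F I)} (hJ : J ≤ IdL b ρ)
    (r : ℕ → DiffPoly F I →ₗ[F] DiffPoly F I) (hrJ : ∀ j, J ≤ J.comap (r j))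
    (hr : ∀ i j f, r i (r j f) - r j (r i f) ∈ J)
    (hz : ∀ i j, r i (X b j 1 - X b j (ι F e)) - r j (X b i 1 - X b i (ι F e)) ∈ J)
    (hgen : ∀ V : Submodule F (DiffPoly F I), J ≤ V → (∀ j, X b j 1 ∈ V) →
      (∀ j, X b j (ι F e) ∈ V) → (∀ j, ∀ f ∈ V, r j f ∈ V) → V = ⊤)
    (hα : ∀ a j f, α (evalAt b ρ a (r j f)) = α (a j) * α (evalAt b ρ a f))
    (hβ : ∀ a j f, β (evalAt b ρ a (r j f)) = α (a j) * β (evalAt b ρ a f)) :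
    IdL b ρ ≤ J := by
  intro f hf
  choose p hp1 hp2 using H.exists_eq
  have hlift : ∀ (θ : A →ₗ[F] F) (a : ℕ → A),
      J ≤ LinearMap.ker (θ ∘ₗ (evalAt b ρ a : DiffPoly F I →ₗ[F] A)) := by
    intro θ a g hg
    have : evalAt b ρ a g = 0 := hJ hg a
    simp [this]
  have hmk : ∀ (V : Submodule F (DiffPoly F I ⧸ J)), V.comap J.mkQ = ⊤ → V = ⊤ := by
    intro V hV
    rw [← Submodule.map_comap_eq_of_surjective J.mkQ_surjective V, hV, Submodule.map_top,
      Submodule.range_mkQ]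
  rw [← Submodule.Quotient.mk_eq_zero]
  refine eq_zero_of_evaluations (F := F) (r := fun j => J.mapQ J (r j) (hrJ j))
    (y := fun j => J.mkQ (X b j (ι F e))) (z := fun j => J.mkQ (X b j 1 - X b j (ι F e)))
    ?_ ?_ ?_ (fun s t => J.liftQ _ (hlift α fun j => p (s j) (t j)))
    (fun s t => J.liftQ _ (hlift β fun j => p (s j) (t j))) ?_ ?_ ?_ ?_ ?_ ?_ ?_ ?_
  · intro i j q
    obtain ⟨g, rfl⟩ := J.mkQ_surjective q
    exact (Submodule.Quotient.eq J).2 (hr i j g)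
  · exact fun i j => (Submodule.Quotient.eq J).2 (hz i j)
  · intro V h1 h2 h3
    refine hmk V (hgen _ ?_ (fun j => ?_) h1 fun j g hg => h3 j _ hg)
    · intro g hg
      rw [Submodule.mem_comap, Submodule.mkQ_apply, (Submodule.Quotient.mk_eq_zero J).2 hg]
      exact zero_mem V
    · have := add_mem (h2 j) (h1 j)
      rwa [← map_add, sub_add_cancel] at this
  · intro s t j q
    obtain ⟨g, rfl⟩ := J.mkQ_surjective q
    simpa [hp1] using hα (fun j => p (s j) (t j)) j g
  · intro s t j
    simp [-UniversalEnvelopingAlgebra.ι_apply, evalAt_X, uAct_ι, H.act_left, hp1]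
  · intro s t j
    simp [-UniversalEnvelopingAlgebra.ι_apply, evalAt_X, uAct_ι, H.act_left]
  · intro s t j q
    obtain ⟨g, rfl⟩ := J.mkQ_surjective q
    simpa [hp1] using hβ (fun j => p (s j) (t j)) j g
  · intro s t j
    simp [-UniversalEnvelopingAlgebra.ι_apply, evalAt_X, uAct_ι, H.act_right, he]
  · intro s t j
    simp [-UniversalEnvelopingAlgebra.ι_apply, evalAt_X, uAct_ι, H.act_right, he, hp2]
  · intro s t
    have := hf fun j => p (s j) (t j)
    simp [this]
  · intro s t
    have := hf fun j => p (s j) (t j)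
    simp [this]

theorem single_mk_cons (p q : ℕ × I) (l : List (ℕ × I)) :
    (MonoidAlgebra.single ⟨p, q :: l⟩ 1 : DiffPoly F I) =
      MonoidAlgebra.single (FreeSemigroup.of p) 1 * MonoidAlgebra.single ⟨q, l⟩ 1 := by
  rw [MonoidAlgebra.single_mul_single, one_mul]; rfl

theorem single_mk_concat (p q : ℕ × I) (l : List (ℕ × I)) :
    (MonoidAlgebra.single ⟨p, l ++ [q]⟩ 1 : DiffPoly F I) =
      MonoidAlgebra.single ⟨p, l⟩ 1 * MonoidAlgebra.single (FreeSemigroup.of q) 1 := by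
  rw [MonoidAlgebra.single_mul_single, one_mul]; rfl

theorem eq_top_of_single_mem {V : Submodule F (DiffPoly F I)}
    (h : ∀ p l, MonoidAlgebra.single (⟨p, l⟩ : FreeSemigroup (ℕ × I)) (1 : F) ∈ V) : V = ⊤ := by
  refine eq_top_iff.2 fun f _ => ?_
  induction f using MonoidAlgebra.induction_linear with
  | zero => exact zero_mem V
  | add f g hf hg => exact add_mem (hf trivial) (hg trivial)
  | single w k =>
    have := V.smul_mem k (h w.head w.tail)
    simpa using this

/-- If `J ≤ V` and `V` contains the products of `g` with `x_j` and `x_j^e` then it contains the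
product of `g` with every `x_j^h`. -/
theorem IsTIdeal.mul_X_mem {J V : Submodule F (DiffPoly F I)} (hT : IsTIdeal b J) (hJV : J ≤ V)
    {e : L} {j : ℕ} {h : UniversalEnvelopingAlgebra F L}
    (hX : X b j h ∈ J ⊔ Submodule.span F {X b j 1, X b j (ι F e)})
    (g : DiffPoly F I) (h1 : g * X b j 1 ∈ V) (h2 : g * X b j (ι F e) ∈ V) :
    g * X b j h ∈ V := by
  obtain ⟨t, ht, u, hu, htu⟩ := Submodule.mem_sup.1 hX
  obtain ⟨k, k', rfl⟩ := Submodule.mem_span_pair.1 hu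
  rw [← htu, mul_add, mul_add, mul_smul_comm, mul_smul_comm]
  exact add_mem (hJV (hT.mul_left t ht g)) (add_mem (V.smul_mem _ h1) (V.smul_mem _ h2))

theorem IsTIdeal.X_mul_mem {J V : Submodule F (DiffPoly F I)} (hT : IsTIdeal b J) (hJV : J ≤ V)
    {e : L} {j : ℕ} {h : UniversalEnvelopingAlgebra F L}
    (hX : X b j h ∈ J ⊔ Submodule.span F {X b j 1, X b j (ι F e)})
    (g : DiffPoly F I) (h1 : X b j 1 * g ∈ V) (h2 : X b j (ι F e) * g ∈ V) :
    X b j h * g ∈ V := by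
  obtain ⟨t, ht, u, hu, htu⟩ := Submodule.mem_sup.1 hX
  obtain ⟨k, k', rfl⟩ := Submodule.mem_span_pair.1 hu
  rw [← htu, add_mul, add_mul, smul_mul_assoc, smul_mul_assoc]
  exact add_mem (hJV (hT.mul_right t ht g)) (add_mem (V.smul_mem _ h1) (V.smul_mem _ h2))

theorem X_mem_of_le {J V : Submodule F (DiffPoly F I)} (hJV : J ≤ V) {e : L} {j : ℕ}
    {h : UniversalEnvelopingAlgebra F L}
    (hX : X b j h ∈ J ⊔ Submodule.span F {X b j 1, X b j (ι F e)})
    (h1 : X b j 1 ∈ V) (h2 : X b j (ι F e) ∈ V) : X b j h ∈ V :=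
  (sup_le hJV (Submodule.span_le.2 (by rintro _ (rfl | rfl) <;> assumption)) : _ ≤ V) hX

/-! ### The listed generators and the ideals of identities -/

theorem gens₁_subset_IdL (H : IsCoordinates ρ α β c) (hmul : ∀ x y, β (x * y) = β x * α y)
    {e : L} (he : c e = 1) : gens₁ b e ⊆ IdL b ρ := by
  rintro _ (rfl | rfl | rfl) a <;> refine H.eq_zero _ ?_ ?_ <;>
    simp [-UniversalEnvelopingAlgebra.ι_apply, evalAt_X, uAct_ι, H.act_left,
      H.act_right, he, H.mul, hmul, pow_two]
  all_goals ring

theorem gens₂_subset_IdL (H : IsCoordinates ρ α β c) (hmul : ∀ x y, β (x * y) = α x * β y)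
    {e : L} (he : c e = 1) : gens₂ b e ⊆ IdL b ρ := by
  rintro _ (rfl | rfl | rfl) a <;> refine H.eq_zero _ ?_ ?_ <;>
    simp [-UniversalEnvelopingAlgebra.ι_apply, evalAt_X, uAct_ι, H.act_left,
      H.act_right, he, H.mul, hmul, pow_two]
  all_goals ring

theorem trivial_subset_IdL :
    {f | ∃ γ : L, ρ γ = 0 ∧ f = X b 0 (ι F γ)} ⊆ (IdL b ρ : Set (DiffPoly F I)) := by
  rintro _ ⟨γ, hγ, rfl⟩ a
  simp [-UniversalEnvelopingAlgebra.ι_apply, evalAt_X, uAct_ι, hγ]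

/-- The element γ - c(γ)e acts as zero, so its polynomial is one of the trivial identities. -/
theorem exists_X_sub_smul_mem (hρ : ∀ γ, ρ γ = c γ • ρ e) {J : Submodule F (DiffPoly F I)}
    (hJ : {f | ∃ γ : L, ρ γ = 0 ∧ f = X b 0 (ι F γ)} ⊆ (J : Set (DiffPoly F I))) (γ : L) :
    ∃ k : F, X b 0 (ι F γ) - k • X b 0 (ι F e) ∈ J := by
  refine ⟨c γ, hJ ⟨γ - c γ • e, ?_, ?_⟩⟩
  · rw [map_sub, map_smul, hρ γ, sub_self]
  · simp

theorem IdL_eq_TSpan₁ [Infinite F] (H : IsCoordinates ρ α β c)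
    (hmul : ∀ x y, β (x * y) = β x * α y) {e : L} (he : c e = 1) (hρ : ∀ γ, ρ γ = c γ • ρ e) :
    IdL b ρ = TSpan b (gens₁ b e ∪ {f | ∃ γ : L, ρ γ = 0 ∧ f = X b 0 (ι F γ)}) := by
  set J := TSpan b (gens₁ b e ∪ {f | ∃ γ : L, ρ γ = 0 ∧ f = X b 0 (ι F γ)})
  have hT : IsTIdeal b J := isTIdeal_TSpan b _
  have hS := subset_TSpan b (gens₁ b e ∪ {f | ∃ γ : L, ρ γ = 0 ∧ f = X b 0 (ι F γ)})
  have hle : J ≤ IdL b ρ := TSpan_le b (isTIdeal_IdL b ρ)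
    (Set.union_subset (gens₁_subset_IdL H hmul he) trivial_subset_IdL)
  -- The generator x y^e with an arbitrary polynomial f substituted for x.
  have hy : ∀ f j, f * X b j (ι F e) ∈ J := fun f j => by
    have := hT.evalAt_mem (fun i => if i = 0 then f else X b j 1)
      (hS (Or.inl (Or.inl rfl)))
    simpa [-UniversalEnvelopingAlgebra.ι_apply, evalAt_X, uAct_freeAct_X] using this
  have hc : ∀ i j, X b i (ι F e) * X b j 1 - X b j (ι F e) * X b i 1 -
      (X b i 1 * X b j 1 - X b j 1 * X b i 1) ∈ J := fun i j => by
    have := hT.evalAt_mem (fun k => if k = 0 then X b i 1 else X b j 1)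
      (hS (Or.inl (Or.inr (Or.inl rfl))))
    simpa [-UniversalEnvelopingAlgebra.ι_apply, evalAt_X, uAct_freeAct_X] using this
  have hX := hT.X_mem e (hS (Or.inl (Or.inr (Or.inr rfl))))
    (exists_X_sub_smul_mem hρ (Set.subset_union_right.trans hS))
  refine le_antisymm (IdL_le_of_operators H he hle (fun j => LinearMap.mulRight F (X b j 1))
    (fun j f hf => hT.mul_right f hf _) (fun i j f => ?_) (fun i j => ?_) ?_ ?_ ?_) hle
  -- Multiplied on the left by f, the second generator loses its two terms with an exponent e,
  -- because f x_i^e and f x_j^e lie in J. What remains is the commutator.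
  · have h := hT.mul_left _ (hc i j) f
    have h1 := hT.mul_right _ (hy f i) (X b j 1)
    have h2 := hT.mul_right _ (hy f j) (X b i 1)
    convert add_mem h (sub_mem h2 h1) using 1
    simp only [LinearMap.mulRight_apply, mul_sub, mul_assoc]
    abel
  · convert hc i j using 1
    simp only [LinearMap.mulRight_apply, sub_mul]
    abel
  · intro V hJV h1 h2 h3
    refine eq_top_of_single_mem fun p l => ?_
    -- Words are built up from the left: appending a plain variable applies an operator, and
    -- appending x_j^e lands in J.
    induction l using List.reverseRecOn with
    | nil =>
      have := X_mem_of_le hJV (hX p.1 (b p.2)) (h1 p.1) (h2 p.1)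
      rwa [X_basis] at this
    | append_singleton l q ih =>
      rw [single_mk_concat]
      have := hT.mul_X_mem hJV (hX q.1 (b q.2)) _ (h3 q.1 _ ih) (hJV (hy _ q.1))
      rwa [X_basis] at this
  · intro a j f
    simp [-UniversalEnvelopingAlgebra.ι_apply, H.mul, evalAt_X, mul_comm]
  · intro a j f
    simp [-UniversalEnvelopingAlgebra.ι_apply, hmul, evalAt_X, mul_comm]

/-- The mirror image of `IdL_eq_TSpan₁`: the operators are left multiplications, words grow on the
left, and the roles of i and j in the second generator are exchanged. -/
theorem IdL_eq_TSpan₂ [Infinite F] (H : IsCoordinates ρ α β c)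
    (hmul : ∀ x y, β (x * y) = α x * β y) {e : L} (he : c e = 1) (hρ : ∀ γ, ρ γ = c γ • ρ e) :
    IdL b ρ = TSpan b (gens₂ b e ∪ {f | ∃ γ : L, ρ γ = 0 ∧ f = X b 0 (ι F γ)}) := by
  set J := TSpan b (gens₂ b e ∪ {f | ∃ γ : L, ρ γ = 0 ∧ f = X b 0 (ι F γ)})
  have hT : IsTIdeal b J := isTIdeal_TSpan b _
  have hS := subset_TSpan b (gens₂ b e ∪ {f | ∃ γ : L, ρ γ = 0 ∧ f = X b 0 (ι F γ)})
  have hle : J ≤ IdL b ρ := TSpan_le b (isTIdeal_IdL b ρ)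
    (Set.union_subset (gens₂_subset_IdL H hmul he) trivial_subset_IdL)
  have hy : ∀ f j, X b j (ι F e) * f ∈ J := fun f j => by
    have := hT.evalAt_mem (fun i => if i = 0 then X b j 1 else f)
      (hS (Or.inl (Or.inl rfl)))
    simpa [-UniversalEnvelopingAlgebra.ι_apply, evalAt_X, uAct_freeAct_X] using this
  have hc : ∀ i j, X b i 1 * X b j (ι F e) - X b j 1 * X b i (ι F e) -
      (X b i 1 * X b j 1 - X b j 1 * X b i 1) ∈ J := fun i j => by
    have := hT.evalAt_mem (fun k => if k = 0 then X b i 1 else X b j 1)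
      (hS (Or.inl (Or.inr (Or.inl rfl))))
    simpa [-UniversalEnvelopingAlgebra.ι_apply, evalAt_X, uAct_freeAct_X] using this
  have hX := hT.X_mem e (hS (Or.inl (Or.inr (Or.inr rfl))))
    (exists_X_sub_smul_mem hρ (Set.subset_union_right.trans hS))
  refine le_antisymm (IdL_le_of_operators H he hle (fun j => LinearMap.mulLeft F (X b j 1))
    (fun j f hf => hT.mul_left f hf _) (fun i j f => ?_) (fun i j => ?_) ?_ ?_ ?_) hle
  · have h := hT.mul_right _ (hc j i) f
    have h1 := hT.mul_left _ (hy f i) (X b j 1)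
    have h2 := hT.mul_left _ (hy f j) (X b i 1)
    convert add_mem h (sub_mem h2 h1) using 1
    simp only [LinearMap.mulLeft_apply, sub_mul, mul_assoc]
    abel
  · convert hc j i using 1
    simp only [LinearMap.mulLeft_apply, mul_sub]
    abel
  · intro V hJV h1 h2 h3
    refine eq_top_of_single_mem fun p l => ?_
    induction l generalizing p with
    | nil =>
      have := X_mem_of_le hJV (hX p.1 (b p.2)) (h1 p.1) (h2 p.1)
      rwa [X_basis] at this
    | cons q l ih =>
      rw [single_mk_cons]
      have := hT.X_mul_mem hJV (hX p.1 (b p.2)) _ (h3 p.1 _ (ih q)) (hJV (hy _ p.1))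
      rwa [X_basis] at this
  · intro a j f
    simp [-UniversalEnvelopingAlgebra.ι_apply, H.mul, evalAt_X]
  · intro a j f
    simp [-UniversalEnvelopingAlgebra.ι_apply, hmul, evalAt_X]

end Identities

/-! ### Codimensions and cocharacters -/

section Multilinear

variable {F L I : Type*} [Field F] [LieRing L] [LieAlgebra F L]
  {b : Basis I F (UniversalEnvelopingAlgebra F L)}
  {A : Type*} [NonUnitalRing A] [Module F A] [IsScalarTower F A A] [SMulCommClass F A A]
  {ρ : L →ₗ⁅F⁆ Der F A} {α β : A →ₗ[F] F} {c : L → F}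

open UniversalEnvelopingAlgebra (ι)

/-- The universal enveloping algebra acts diagonally in the coordinates `α`, `β`. -/
theorem IsCoordinates.exists_weights (H : IsCoordinates ρ α β c) :
    ∃ χ ψ : UniversalEnvelopingAlgebra F L →ₗ[F] F,
      (∀ h x, α (uAct ρ h x) = χ h * α x) ∧ (∀ h x, β (uAct ρ h x) = ψ h * β x) ∧
      χ 1 = 1 ∧ ψ 1 = 1 ∧ ∀ γ, χ (ι F γ) = 0 ∧ ψ (ι F γ) = c γ := by
  obtain ⟨u, hu, -⟩ := H.exists_eq 1 0
  obtain ⟨v, -, hv⟩ := H.exists_eq 0 1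
  -- The elements acting diagonally, their weights being read off at a vector u with α = 1 and a
  -- vector v with β = 1.
  let V : Submodule F (UniversalEnvelopingAlgebra F L) :=
    { carrier := {h | ∀ x, α (uAct ρ h x) = α (uAct ρ h u) * α x ∧
        β (uAct ρ h x) = β (uAct ρ h v) * β x}
      zero_mem' := fun x => by simp
      add_mem' := fun {h h'} hh hh' x => by
        simp [(hh x).1, (hh x).2, (hh' x).1, (hh' x).2, add_mul]
      smul_mem' := fun k h hh x => by
        simp [(hh x).1, (hh x).2, mul_assoc] }
  have hV : V = ⊤ := universalEnveloping_eq_top (fun x => by simp [hu, hv]) fun γ h hh x => by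
    simp only [uAct_ι_mul, H.act_left, H.act_right, zero_mul, true_and]
    rw [(hh x).2]; ring
  have hV' : ∀ h, h ∈ V := fun h => hV ▸ Submodule.mem_top
  refine ⟨α ∘ₗ (LinearMap.applyₗ u).comp (uAct ρ).toLinearMap,
    β ∘ₗ (LinearMap.applyₗ v).comp (uAct ρ).toLinearMap, fun h x => (hV' h x).1,
    fun h x => (hV' h x).2, by simpa using hu, by simpa using hv, fun γ => ?_⟩
  simp [-UniversalEnvelopingAlgebra.ι_apply, uAct_ι, H.act_left, H.act_right, hv]

variable {χ ψ : UniversalEnvelopingAlgebra F L → F}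

/-! ### Values of words in the two coordinates -/

theorem eval_word_left (hmul : ∀ x y, α (x * y) = α x * α y)
    (hχ : ∀ h x, α (uAct ρ h x) = χ h * α x) (a : ℕ → A) (l : List (ℕ × I)) (p : ℕ × I) :
    α (evalAt b ρ a (MonoidAlgebra.single ⟨p, l⟩ 1)) =
      ((p :: l).map fun p => χ (b p.2) * α (a p.1)).prod := by
  have h1 : ∀ p : ℕ × I, α (evalAt b ρ a (MonoidAlgebra.single (FreeSemigroup.of p) 1)) =
      χ (b p.2) * α (a p.1) := fun p => by
    rw [← X_basis b p.1 p.2, evalAt_X, hχ]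
  induction l generalizing p with
  | nil => rw [List.map_cons, List.map_nil, List.prod_singleton]; exact h1 p
  | cons q l ih => rw [single_mk_cons, map_mul, hmul, ih, h1, List.map_cons (l := q :: l), List.prod_cons]

theorem eval_word_cons (hmul : ∀ x y, α (x * y) = α x * α y)
    (hχ : ∀ h x, α (uAct ρ h x) = χ h * α x) (hψ : ∀ h x, β (uAct ρ h x) = ψ h * β x)
    (hmul' : ∀ x y, β (x * y) = β x * α y) (a : ℕ → A) (l : List (ℕ × I)) (p : ℕ × I) :
    β (evalAt b ρ a (MonoidAlgebra.single ⟨p, l⟩ 1)) =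
      ψ (b p.2) * β (a p.1) * (l.map fun p => χ (b p.2) * α (a p.1)).prod := by
  have h1 : β (evalAt b ρ a (MonoidAlgebra.single (FreeSemigroup.of p) 1)) =
      ψ (b p.2) * β (a p.1) := by rw [← X_basis b p.1 p.2, evalAt_X, hψ]
  cases l with
  | nil => rw [List.map_nil, List.prod_nil, mul_one]; exact h1
  | cons q l => rw [single_mk_cons, map_mul, hmul', h1, eval_word_left hmul hχ]

theorem eval_word_concat (hmul : ∀ x y, α (x * y) = α x * α y)
    (hχ : ∀ h x, α (uAct ρ h x) = χ h * α x) (hψ : ∀ h x, β (uAct ρ h x) = ψ h * β x)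
    (hmul' : ∀ x y, β (x * y) = α x * β y) (a : ℕ → A) (l l' : List (ℕ × I)) (p q : ℕ × I)
    (h : p :: l = l' ++ [q]) :
    β (evalAt b ρ a (MonoidAlgebra.single ⟨p, l⟩ 1)) =
      ψ (b q.2) * β (a q.1) * (l'.map fun p => χ (b p.2) * α (a p.1)).prod := by
  have h1 : β (evalAt b ρ a (MonoidAlgebra.single (FreeSemigroup.of q) 1)) =
      ψ (b q.2) * β (a q.1) := by rw [← X_basis b q.1 q.2, evalAt_X, hψ]
  cases l' with
  | nil =>
    obtain ⟨rfl, rfl⟩ := List.cons_eq_cons.1 h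
    rw [List.map_nil, List.prod_nil, mul_one]; exact h1
  | cons p' l' =>
    obtain ⟨rfl, rfl⟩ := List.cons_eq_cons.1 h
    rw [List.append_eq, single_mk_concat, map_mul, hmul', h1, eval_word_left hmul hχ, mul_comm]

variable (b ρ α β χ ψ) in
/-- The value of a multilinear word in the coordinates `α`, `β` is a product in which the letter
at the position `k₀` contributes its coordinate `β` to the coordinate `β` of the value, and all
other letters contribute their coordinates `α`. -/
def WordsEvalAt {n : ℕ} (k₀ : Fin n) : Prop :=
  ∀ (σ : Equiv.Perm (Fin n)) (h : Fin n → I) (w : FreeSemigroup (ℕ × I)),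
    w.head :: w.tail = (List.ofFn fun k => ((σ k : ℕ), h k)) → ∀ a : ℕ → A,
    α (evalAt b ρ a (MonoidAlgebra.single w 1)) = ∏ k, χ (b (h k)) * α (a (σ k)) ∧
    β (evalAt b ρ a (MonoidAlgebra.single w 1)) = ψ (b (h k₀)) * β (a (σ k₀)) *
      ∏ k ∈ Finset.univ.erase k₀, χ (b (h k)) * α (a (σ k))

theorem wordsEvalAt_zero (hmul : ∀ x y, α (x * y) = α x * α y)
    (hχ : ∀ h x, α (uAct ρ h x) = χ h * α x) (hψ : ∀ h x, β (uAct ρ h x) = ψ h * β x)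
    (hmul' : ∀ x y, β (x * y) = β x * α y) (n : ℕ) :
    WordsEvalAt b ρ α β χ ψ (0 : Fin (n + 1)) := by
  rintro σ h ⟨p, l⟩ hw a
  change p :: l = _ at hw
  constructor
  · rw [eval_word_left hmul hχ, hw, List.map_ofFn, List.prod_ofFn]
    rfl
  · rw [List.ofFn_succ] at hw
    obtain ⟨rfl, rfl⟩ := List.cons_eq_cons.1 hw
    rw [eval_word_cons hmul hχ hψ hmul', List.map_ofFn, List.prod_ofFn]
    have : (Finset.univ.erase (0 : Fin (n + 1))) = Finset.univ.map (Fin.succEmb n) := by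
      ext k
      rw [Finset.mem_erase, Finset.mem_map]
      simp [Fin.exists_succ_eq]
    rw [this, Finset.prod_map]
    rfl

theorem wordsEvalAt_last (hmul : ∀ x y, α (x * y) = α x * α y)
    (hχ : ∀ h x, α (uAct ρ h x) = χ h * α x) (hψ : ∀ h x, β (uAct ρ h x) = ψ h * β x)
    (hmul' : ∀ x y, β (x * y) = α x * β y) (n : ℕ) :
    WordsEvalAt b ρ α β χ ψ (Fin.last n) := by
  rintro σ h ⟨p, l⟩ hw a
  change p :: l = _ at hw
  constructor
  · rw [eval_word_left hmul hχ, hw, List.map_ofFn, List.prod_ofFn]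
    rfl
  · rw [List.ofFn_succ', List.concat_eq_append] at hw
    rw [eval_word_concat hmul hχ hψ hmul' a _ _ _ _ hw, List.map_ofFn, List.prod_ofFn]
    have : (Finset.univ.erase (Fin.last n)) = Finset.univ.map Fin.castSuccEmb := by
      ext k
      rw [Finset.mem_erase, Finset.mem_map]
      simp [Fin.exists_castSucc_eq]
    rw [this, Finset.prod_map]
    rfl

variable (b ρ α β) in
/-- The coordinates of a multilinear differential polynomial modulo the identities: its values
when all variables are `u`, and when the variable `j` is `v` and all others are `u`. -/
noncomputable def multilinearCoord (u v : A) (n : ℕ) : DiffPoly F I →ₗ[F] F × (Fin n → F) :=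
  (α ∘ₗ (evalAt b ρ fun _ => u : DiffPoly F I →ₗ[F] A)).prod
    (LinearMap.pi fun j : Fin n =>
      β ∘ₗ (evalAt b ρ (Function.update (fun _ => u) (j : ℕ) v) : DiffPoly F I →ₗ[F] A))

theorem multilinearCoord_apply (u v : A) (n : ℕ) (f : DiffPoly F I) :
    multilinearCoord b ρ α β u v n f = (α (evalAt b ρ (fun _ => u) f),
      fun j : Fin n => β (evalAt b ρ (Function.update (fun _ => u) (j : ℕ) v) f)) := rfl

/-- Permuting the variables of f turns the point with v in place j into the point with v in place
σ⁻¹ j, and fixes the constant point. -/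
theorem multilinearCoord_permRep (u v : A) (n : ℕ) (σ : Equiv.Perm (Fin n)) (f : DiffPoly F I) :
    multilinearCoord b ρ α β u v n (permRep F I n σ f) =
      (LinearMap.id.prodMap (LinearMap.funLeft F F ⇑σ⁻¹)) (multilinearCoord b ρ α β u v n f) := by
  simp only [multilinearCoord_apply, evalAt_permRep, LinearMap.prodMap_apply, LinearMap.id_apply]
  refine Prod.ext rfl (funext fun j => ?_)
  have : (fun i => Function.update (fun _ => u) (j : ℕ) v (extPerm n σ i)) =
      Function.update (fun _ => u) ((σ⁻¹ j : Fin n) : ℕ) v := by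
    funext i
    rw [← extPerm_apply, map_inv]
    by_cases h : extPerm n σ i = j
    · rw [h, ← h]; simp
    · have h' : i ≠ (extPerm n σ)⁻¹ j := by
        rintro rfl; simp at h
      rw [Function.update_of_ne h, Function.update_of_ne h']
  change β (evalAt b ρ (fun i => Function.update (fun _ => u) (j : ℕ) v (extPerm n σ i)) f) = _
  rw [this]
  rfl

section

variable {u v : A} {n : ℕ} {k₀ : Fin n}

/-- Since β(u) = 0, the β-part survives only when v is the variable at the distinguished position
k₀. There v enters only through β, so α(v) does not matter. -/
theorem multilinearCoord_word (hw : WordsEvalAt b ρ α β χ ψ k₀) (hu : α u = 1) (hu' : β u = 0)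
    (hv' : β v = 1) (σ : Equiv.Perm (Fin n)) (h : Fin n → I) (w : FreeSemigroup (ℕ × I))
    (hwσ : w.head :: w.tail = List.ofFn fun k => ((σ k : ℕ), h k)) :
    multilinearCoord b ρ α β u v n (MonoidAlgebra.single w 1) = (∏ k, χ (b (h k)),
      Pi.single (σ k₀) (ψ (b (h k₀)) * ∏ k ∈ Finset.univ.erase k₀, χ (b (h k)))) := by
  rw [multilinearCoord_apply, (hw σ h w hwσ _).1]
  refine Prod.ext (by simp [hu]) (funext fun j => ?_)
  simp only [(hw σ h w hwσ _).2]
  by_cases hj : j = σ k₀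
  · subst hj
    rw [Pi.single_eq_same, Function.update_self, hv', mul_one]
    congr 1
    refine Finset.prod_congr rfl fun k hk => ?_
    have : ((σ k : Fin n) : ℕ) ≠ σ k₀ := fun h => Finset.ne_of_mem_erase hk
      (σ.injective (Fin.ext h))
    simp [this, hu]
  · have : ((σ k₀ : Fin n) : ℕ) ≠ j := fun h => hj (Fin.ext h.symm)
    rw [Pi.single_eq_of_ne hj, Function.update_of_ne this, hu']
    simp

/-- A multilinear differential polynomial is determined modulo identities by its coordinates. -/
theorem eval_eq_of_mem_multilinear (hw : WordsEvalAt b ρ α β χ ψ k₀) (hu : α u = 1)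
    (hu' : β u = 0) (hv' : β v = 1) {f : DiffPoly F I} (hf : f ∈ multilinear F I n)
    (a : ℕ → A) :
    α (evalAt b ρ a f) = (multilinearCoord b ρ α β u v n f).1 * ∏ i : Fin n, α (a i) ∧
    β (evalAt b ρ a f) = ∑ j : Fin n, (multilinearCoord b ρ α β u v n f).2 j *
      (β (a j) * ∏ i ∈ Finset.univ.erase j, α (a i)) := by
  induction hf using Submodule.span_induction with
  | mem f hf =>
    obtain ⟨w, ⟨σ, h, hwσ⟩, rfl⟩ := hf
    dsimp only
    rw [multilinearCoord_word hw hu hu' hv' σ h w hwσ, (hw σ h w hwσ a).1, (hw σ h w hwσ a).2]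
    constructor
    · rw [Finset.prod_mul_distrib, Equiv.prod_comp σ fun i : Fin n => α (a i)]
    · rw [Finset.sum_eq_single (σ k₀) (fun j _ hj => by simp [hj]) (by simp)]
      have : ∏ i ∈ Finset.univ.erase (σ k₀), α (a i) =
          ∏ k ∈ Finset.univ.erase k₀, α (a (σ k)) :=
        (Finset.prod_equiv σ (by simp) (fun _ _ => rfl)).symm
      rw [this, Finset.prod_mul_distrib]
      simp only [Pi.single_eq_same]
      ring
  | zero => simp
  | add f g _ _ hf hg =>
    simp only [map_add, hf.1, hf.2, hg.1, hg.2, Prod.fst_add, Prod.snd_add, Pi.add_apply, add_mul,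
      Finset.sum_add_distrib, and_self]
  | smul k f _ hf =>
    simp only [map_smul, hf.1, hf.2, Prod.smul_fst, Prod.smul_snd, Pi.smul_apply, smul_eq_mul,
      Finset.mul_sum, mul_assoc, and_self]

theorem exists_multilinearCoord_eq {χ ψ : UniversalEnvelopingAlgebra F L →ₗ[F] F}
    (hw : WordsEvalAt b ρ α β χ ψ k₀) (hu : α u = 1) (hu' : β u = 0) (hv' : β v = 1)
    (hχ1 : χ 1 = 1) (hψ1 : ψ 1 = 1) {e : L} (hχe : χ (ι F e) = 0) (hψe : ψ (ι F e) = 1) :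
    (multilinear F I n).map (multilinearCoord b ρ α β u v n) = ⊤ := by
  -- The basis of U(L) need not contain 1. A basis element of nonzero weight fills all positions
  -- except k₀, and its power is divided out afterwards.
  obtain ⟨i₀, hi₀⟩ : ∃ i, χ (b i) ≠ 0 := by
    by_contra! h
    have : χ = 0 := b.ext fun i => by simp [h i]
    simp [this] at hχ1
  set W := (multilinear F I n).map (multilinearCoord b ρ α β u v n)
  have hcard : ∀ i : I, ∏ k ∈ Finset.univ.erase k₀, χ (b (Function.update (fun _ => i₀) k₀ i k)) =
      χ (b i₀) ^ (n - 1) := by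
    intro i
    rw [Finset.prod_congr rfl fun k hk => by
      rw [Function.update_of_ne (Finset.ne_of_mem_erase hk)]]
    simp
  have hbasis : ∀ (j : Fin n) (i : I), (χ (b i), Pi.single j (ψ (b i))) ∈ W := by
    intro j i
    -- The swap puts variable j at the distinguished position.
    set σ : Equiv.Perm (Fin n) := Equiv.swap k₀ j with hσ
    set h : Fin n → I := Function.update (fun _ => i₀) k₀ i with hh
    obtain ⟨w, hwσ⟩ : ∃ w : FreeSemigroup (ℕ × I),
        w.head :: w.tail = List.ofFn fun k => ((σ k : ℕ), h k) := by
      cases n with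
      | zero => exact k₀.elim0
      | succ n => exact ⟨⟨((σ 0 : ℕ), h 0), List.ofFn fun k => ((σ k.succ : ℕ), h k.succ)⟩,
        (List.ofFn_succ (f := fun k => ((σ k : ℕ), h k))).symm⟩
    have hmem : multilinearCoord b ρ α β u v n (MonoidAlgebra.single w 1) ∈ W :=
      Submodule.mem_map_of_mem (Submodule.subset_span ⟨w, ⟨σ, h, hwσ⟩, rfl⟩)
    rw [multilinearCoord_word hw hu hu' hv' σ h w hwσ,
      ← Finset.mul_prod_erase _ _ (Finset.mem_univ k₀), hcard, hσ, Equiv.swap_apply_left, hh,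
      Function.update_self] at hmem
    have := W.smul_mem (χ (b i₀) ^ (n - 1))⁻¹ hmem
    have hne := pow_ne_zero (n - 1) hi₀
    convert this using 1
    refine Prod.ext ?_ ?_
    · simp [mul_comm (χ (b i)), hne]
    · rw [Prod.smul_snd, ← Pi.single_smul, smul_eq_mul, mul_comm (ψ (b i)),
        inv_mul_cancel_left₀ hne]
  have hall : ∀ (j : Fin n) (h : UniversalEnvelopingAlgebra F L),
      (χ h, Pi.single j (ψ h)) ∈ W := by
    intro j h
    have : LinearMap.range (χ.prod ((LinearMap.single F (fun _ : Fin n => F) j).comp ψ)) ≤ W := by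
      rw [LinearMap.range_eq_map, ← b.span_eq, Submodule.map_span, Submodule.span_le]
      rintro _ ⟨_, ⟨i, rfl⟩, rfl⟩
      exact hbasis j i
    exact this ⟨h, rfl⟩
  -- The exponent at position k₀ may now be any element of U(L): e gives the unit vectors of F^n,
  -- and 1 minus e gives the unit vector of the first summand.
  have h2 : ∀ j : Fin n, ((0 : F), (Pi.single j 1 : Fin n → F)) ∈ W := fun j => by
    simpa only [hχe, hψe] using hall j (ι F e)
  have h1 : ((1 : F), (0 : Fin n → F)) ∈ W := by
    have := sub_mem (hall k₀ 1) (h2 k₀)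
    simpa [hχ1, hψ1] using this
  refine eq_top_iff.2 fun ⟨s, t⟩ _ => ?_
  have : ((s, t) : F × (Fin n → F)) = s • ((1 : F), (0 : Fin n → F)) +
      ∑ j, t j • ((0 : F), (Pi.single j 1 : Fin n → F)) := by
    refine Prod.ext ?_ ?_
    · simp [Prod.fst_sum]
    · simp only [Prod.snd_add, Prod.smul_snd, smul_zero, zero_add, Prod.snd_sum]
      conv_lhs => rw [pi_eq_sum_univ' t]
  rw [this]
  exact add_mem (W.smul_mem _ h1) (sum_mem fun j _ => W.smul_mem _ (h2 j))

/-- `P_n^L` modulo the identities is the sum of the trivial module and the permutation module. -/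
theorem exists_multilinearEquiv (H : IsCoordinates ρ α β c) {e : L} (he : c e = 1)
    {χ ψ : UniversalEnvelopingAlgebra F L →ₗ[F] F} (hw : WordsEvalAt b ρ α β χ ψ k₀)
    (hχ1 : χ 1 = 1) (hψ1 : ψ 1 = 1) (hι : ∀ γ, χ (ι F γ) = 0 ∧ ψ (ι F γ) = c γ) :
    ∃ E : (multilinear F I n ⧸ multilinearId b ρ n) ≃ₗ[F] F × (Fin n → F),
      ∀ σ x, E (((multilinearRep F I n).quotient (multilinearId b ρ n)
        (multilinearId_le b ρ n)) σ x) =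
        (LinearMap.id.prodMap (LinearMap.funLeft F F ⇑σ⁻¹)) (E x) := by
  obtain ⟨u, hu, hu'⟩ := H.exists_eq 1 0
  obtain ⟨v, -, hv'⟩ := H.exists_eq 0 1
  let Φ := multilinearCoord b ρ α β u v n ∘ₗ (multilinear F I n).subtype
  have hΦ : Function.Surjective Φ := by
    rw [← LinearMap.range_eq_top, LinearMap.range_comp, Submodule.range_subtype]
    exact exists_multilinearCoord_eq hw hu hu' hv' hχ1 hψ1 (hι e).1 ((hι e).2.trans he)
  -- By `eval_eq_of_mem_multilinear`, vanishing at the n + 1 test points forces vanishing at every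
  -- point.
  have hker : multilinearId b ρ n = LinearMap.ker Φ := by
    ext f
    refine ⟨fun hf => ?_, fun hf a => ?_⟩
    · have hf' : ∀ a : ℕ → A, evalAt b ρ a (f : DiffPoly F I) = 0 := hf
      refine LinearMap.mem_ker.2 ?_
      change multilinearCoord b ρ α β u v n (f : DiffPoly F I) = 0
      rw [multilinearCoord_apply]
      simp only [hf', map_zero]
      rfl
    · have hf' : multilinearCoord b ρ α β u v n (f : DiffPoly F I) = 0 := hf
      obtain ⟨h1, h2⟩ := eval_eq_of_mem_multilinear hw hu hu' hv' f.2 a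
      rw [hf'] at h1 h2
      exact H.eq_zero _ (by simpa using h1) (by simpa using h2)
  refine ⟨(Submodule.quotEquivOfEq _ _ hker).trans (Φ.quotKerEquivOfSurjective hΦ),
    fun σ x => ?_⟩
  obtain ⟨f, rfl⟩ := Submodule.mkQ_surjective _ x
  exact multilinearCoord_permRep u v n σ (f : DiffPoly F I)

theorem codim_eq (H : IsCoordinates ρ α β c) {e : L} (he : c e = 1)
    {χ ψ : UniversalEnvelopingAlgebra F L →ₗ[F] F} (hw : WordsEvalAt b ρ α β χ ψ k₀)
    (hχ1 : χ 1 = 1) (hψ1 : ψ 1 = 1) (hι : ∀ γ, χ (ι F γ) = 0 ∧ ψ (ι F γ) = c γ) :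
    codim b ρ n = ((n + 1 : ℕ) : Cardinal) := by
  obtain ⟨E, -⟩ := exists_multilinearEquiv H he hw hχ1 hψ1 hι
  have : Module.Finite F (multilinear F I n ⧸ multilinearId b ρ n) := Module.Finite.equiv E.symm
  rw [codim, ← Module.finrank_eq_rank, E.finrank_eq]
  simp [add_comm]

theorem cochar_eq (H : IsCoordinates ρ α β c) {e : L} (he : c e = 1)
    {χ ψ : UniversalEnvelopingAlgebra F L →ₗ[F] F} (hw : WordsEvalAt b ρ α β χ ψ k₀)
    (hχ1 : χ 1 = 1) (hψ1 : ψ 1 = 1) (hι : ∀ γ, χ (ι F γ) = 0 ∧ ψ (ι F γ) = c γ)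
    (σ : Equiv.Perm (Fin n)) :
    cochar b ρ n σ = 1 + LinearMap.trace F (Fin n → F) (LinearMap.funLeft F F ⇑σ⁻¹) := by
  obtain ⟨E, hE⟩ := exists_multilinearEquiv H he hw hχ1 hψ1 hι
  rw [cochar, Representation.character, ← LinearMap.trace_conj' _ E]
  have : E.conj (((multilinearRep F I n).quotient (multilinearId b ρ n)
      (multilinearId_le b ρ n)) σ) = LinearMap.id.prodMap (LinearMap.funLeft F F ⇑σ⁻¹) := by
    refine LinearMap.ext fun x => ?_
    rw [LinearEquiv.conj_apply_apply, hE, E.apply_symm_apply]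
  rw [this, LinearMap.trace_prodMap', LinearMap.trace_id]
  simp

end

end Multilinear

/-! ### The irreducible characters of the partitions `(n)` and `(n - 1, 1)` -/

section Shapes

variable (F : Type*) [Field F]

theorem mem_rowShape {n : ℕ} {x : ℕ × ℕ} : x ∈ (rowShape n).cells ↔ x.1 = 0 ∧ x.2 < n := by
  rw [YoungDiagram.mem_cells, rowShape, YoungDiagram.mem_ofRowLens]
  obtain ⟨i, j⟩ := x
  constructor
  · rintro ⟨h, hj⟩
    have : i = 0 := by simpa using h
    subst this
    exact ⟨rfl, by simpa using hj⟩
  · rintro ⟨rfl, hj⟩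
    exact ⟨by simp, by simpa using hj⟩

theorem mem_hookShape {n : ℕ} {hn : 2 ≤ n} {x : ℕ × ℕ} :
    x ∈ (hookShape n hn).cells ↔ (x.1 = 0 ∧ x.2 < n - 1) ∨ x = (1, 0) := by
  rw [YoungDiagram.mem_cells, hookShape, YoungDiagram.mem_ofRowLens]
  obtain ⟨i, j⟩ := x
  constructor
  · rintro ⟨h, hj⟩
    have : i < 2 := by simpa using h
    interval_cases i
    · exact Or.inl ⟨rfl, by simpa using hj⟩
    · exact Or.inr (by simpa using hj)
  · rintro (⟨h, hj⟩ | h)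
    · dsimp only at h hj
      subst h
      exact ⟨by simp, by simpa using hj⟩
    · cases h
      exact ⟨by simp, by simp⟩

theorem card_rowShape (n : ℕ) : (rowShape n).cells.card = n := by
  have : (rowShape n).cells = (Finset.range n).image (Prod.mk 0) := by
    ext ⟨i, j⟩
    rw [mem_rowShape]
    simp only [Finset.mem_image, Finset.mem_range, Prod.mk.injEq]
    exact ⟨fun ⟨h, hj⟩ => ⟨j, hj, h.symm, rfl⟩, fun ⟨_, hk, h, hj⟩ => ⟨h.symm, hj ▸ hk⟩⟩
  rw [this, Finset.card_image_of_injective _ (Prod.mk_right_injective 0), Finset.card_range]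

theorem card_hookShape (n : ℕ) (hn : 2 ≤ n) : (hookShape n hn).cells.card = n := by
  have : (hookShape n hn).cells = insert (1, 0) ((Finset.range (n - 1)).image (Prod.mk 0)) := by
    ext ⟨i, j⟩
    rw [mem_hookShape, or_comm]
    simp only [Finset.mem_insert, Finset.mem_image, Finset.mem_range, Prod.mk.injEq]
    exact or_congr Iff.rfl
      ⟨fun ⟨h, hj⟩ => ⟨j, hj, h.symm, rfl⟩, fun ⟨_, hk, h, hj⟩ => ⟨h.symm, hj ▸ hk⟩⟩
  rw [this, Finset.card_insert_of_notMem (by simp),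
    Finset.card_image_of_injective _ (Prod.mk_right_injective 0), Finset.card_range]
  omega

/-! ### Specht modules of the row and hook shapes -/

theorem polytabloid_rowShape {n : ℕ} (T : Fin n ≃ (rowShape n).cells) :
    polytabloid F T = Finsupp.single (fun _ => 0) 1 := by
  -- Each column has a single cell, so the column stabilizer is trivial.
  have hrow : ∀ k, (T k).1.1 = 0 := fun k => (mem_rowShape.1 (T k).2).1
  have hfilter : (Finset.univ.filter fun τ : Equiv.Perm (Fin n) =>
      ∀ k, (T (τ k)).1.2 = (T k).1.2) = {1} := by
    ext τ
    simp only [Finset.mem_filter_univ, Finset.mem_singleton]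
    refine ⟨fun h => Equiv.ext fun k => T.injective (Subtype.ext (Prod.ext ?_ (h k))), ?_⟩
    · rw [hrow, hrow]
    · rintro rfl k; rfl
  rw [polytabloid, hfilter, Finset.sum_singleton]
  simp [hrow]

theorem specht_rowShape (n : ℕ) :
    specht F n (rowShape n) = Submodule.span F {Finsupp.single (fun _ => 0) 1} := by
  have : Nonempty (Fin n ≃ (rowShape n).cells) :=
    ⟨((rowShape n).cells.equivFinOfCardEq (card_rowShape n)).symm⟩
  rw [specht, funext (polytabloid_rowShape F), Set.range_const]

theorem chi_rowShape (n : ℕ) (σ : Equiv.Perm (Fin n)) : chi F n (rowShape n) σ = 1 := by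
  have hid : ((tabloidRep F n).subrepresentation (specht F n (rowShape n))
      (specht_le F (rowShape n))) σ = LinearMap.id := by
    refine LinearMap.ext fun x => Subtype.ext ?_
    obtain ⟨x, hx⟩ := x
    rw [specht_rowShape, Submodule.mem_span_singleton] at hx
    obtain ⟨k, rfl⟩ := hx
    change tabloidRep F n σ (k • Finsupp.single (fun _ => 0) 1) =
      k • Finsupp.single (fun _ => 0) 1
    rw [map_smul]
    simp [tabloidRep]
  rw [chi, Representation.character, hid]
  have : Module.Free F (specht F n (rowShape n)) :=
    Module.Free.of_divisionRing F (specht F n (rowShape n))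
  have : Module.Finite F (specht F n (rowShape n)) := by
    rw [specht_rowShape]; infer_instance
  refine (LinearMap.trace_id F (specht F n (rowShape n))).trans ?_
  rw [specht_rowShape, finrank_span_singleton (by simp), Nat.cast_one]

/-- The permutation module of `S_n`, embedded into the permutation module on all tabloids: the
basis vector `i` goes to the tabloid which has only `i` in row `1`. -/
noncomputable def rowEmbedding (n : ℕ) : (Fin n → F) →ₗ[F] ((Fin n → ℕ) →₀ F) :=
  Fintype.linearCombination F fun i => Finsupp.single (Pi.single i 1) 1

theorem rowEmbedding_single {n : ℕ} (i : Fin n) :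
    rowEmbedding F n (Pi.single i 1) = Finsupp.single (Pi.single i 1) 1 := by
  simp [rowEmbedding]

theorem rowEmbedding_injective (n : ℕ) : Function.Injective (rowEmbedding F n) := by
  have hinj : Function.Injective fun i : Fin n => (Pi.single i 1 : Fin n → ℕ) := fun i j h => by
    have := congrFun h i
    by_contra hij
    simp [hij] at this
  have := ((Finsupp.basisSingleOne (R := F) (ι := Fin n → ℕ)).linearIndependent.comp _ hinj)
  refine (injective_iff_map_eq_zero (rowEmbedding F n)).2 fun x hx =>
    funext (Fintype.linearIndependent_iff.1 this x ?_)
  simpa [rowEmbedding, Fintype.linearCombination_apply] using hx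

theorem tabloidRep_rowEmbedding {n : ℕ} (σ : Equiv.Perm (Fin n)) (x : Fin n → F) :
    tabloidRep F n σ (rowEmbedding F n x) = rowEmbedding F n (LinearMap.funLeft F F ⇑σ⁻¹ x) := by
  have : tabloidRep F n σ ∘ₗ rowEmbedding F n = rowEmbedding F n ∘ₗ LinearMap.funLeft F F ⇑σ⁻¹ := by
    refine LinearMap.pi_ext' fun i => LinearMap.ext_ring ?_
    have h : ∀ {R : Type} [Zero R] (r : R), (fun k => (Pi.single i r : Fin n → R) (σ⁻¹ k)) =
        Pi.single (σ i) r := by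
      intro R _ r
      funext k
      simp [Pi.single_apply, Equiv.symm_apply_eq]
    have h' : LinearMap.funLeft F F ⇑σ⁻¹ (Pi.single i 1) = Pi.single (σ i) 1 := by
      funext k
      simp [LinearMap.funLeft_apply, Pi.single_apply, Equiv.symm_apply_eq]
    simp only [LinearMap.comp_apply, LinearMap.single_apply]
    rw [h', rowEmbedding_single, rowEmbedding_single]
    simp only [tabloidRep, MonoidHom.coe_mk, OneHom.coe_mk, Finsupp.lmapDomain_apply,
      Finsupp.mapDomain_single, h]
  exact LinearMap.congr_fun this x

/-- The sum of the entries of a vector. -/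
noncomputable def entrySum (n : ℕ) : (Fin n → F) →ₗ[F] F := Fintype.linearCombination F fun _ => 1

theorem entrySum_apply {n : ℕ} (x : Fin n → F) : entrySum F n x = ∑ i, x i := by
  simp [entrySum, Fintype.linearCombination_apply]

/-- Only the first column has two cells, so the column stabilizer is generated by the transposition
of their entries i and j. A tabloid is determined by the one entry in its second row, which makes
the signed sum a difference of two basis vectors. -/
theorem polytabloid_hookShape {n : ℕ} (hn : 2 ≤ n) (T : Fin n ≃ (hookShape n hn).cells)
    {i j : Fin n} (hi : (T i).1 = (1, 0)) (hj : (T j).1 = (0, 0)) :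
    polytabloid F T = rowEmbedding F n (Pi.single i 1 - Pi.single j 1) := by
  have hij : i ≠ j := by
    rintro rfl; rw [hi] at hj; simp at hj
  have hrow : ∀ k, k ≠ i → (T k).1.1 = 0 := fun k hk => by
    rcases mem_hookShape.1 (T k).2 with h | h
    · exact h.1
    · exact absurd (T.injective (Subtype.ext (h.trans hi.symm))) hk
  have hrow' : (fun k => (T k).1.1) = Pi.single i 1 := by
    funext k
    by_cases hk : k = i
    · subst hk; simp [hi]
    · rw [hrow k hk, Pi.single_eq_of_ne hk]
  have hcol : ∀ k, (T k).1.2 = 0 → k = i ∨ k = j := fun k hk => by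
    by_cases h : k = i
    · exact Or.inl h
    · exact Or.inr (T.injective (Subtype.ext ((Prod.ext (hrow k h) hk).trans hj.symm)))
  have hfilter : (Finset.univ.filter fun τ : Equiv.Perm (Fin n) =>
      ∀ k, (T (τ k)).1.2 = (T k).1.2) = {1, Equiv.swap i j} := by
    ext τ
    simp only [Finset.mem_filter_univ, Finset.mem_insert, Finset.mem_singleton]
    constructor
    · intro h
      have hfix : ∀ k, k ≠ i → k ≠ j → τ k = k := by
        intro k hki hkj
        have hk0 : (T k).1.2 ≠ 0 := fun h0 => (hcol k h0).elim hki hkj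
        have hτi : τ k ≠ i := fun h' => hk0 (by rw [← h k, h', hi])
        exact T.injective (Subtype.ext (Prod.ext ((hrow _ hτi).trans (hrow _ hki).symm) (h k)))
      have hτi := hcol (τ i) (by rw [h, hi])
      have hτj := hcol (τ j) (by rw [h, hj])
      rcases hτi with hτi | hτi
      · left
        have hτj' : τ j = j := hτj.resolve_left fun h' =>
          hij (τ.injective (hτi.trans h'.symm))
        ext k
        by_cases hki : k = i
        · rw [hki, hτi]; rfl
        by_cases hkj : k = j
        · rw [hkj, hτj']; rfl
        rw [hfix k hki hkj]; rfl
      · right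
        have hτj' : τ j = i := hτj.resolve_right fun h' =>
          hij (τ.injective (hτi.trans h'.symm))
        ext k
        by_cases hki : k = i
        · rw [hki, hτi, Equiv.swap_apply_left]
        by_cases hkj : k = j
        · rw [hkj, hτj', Equiv.swap_apply_right]
        rw [hfix k hki hkj, Equiv.swap_apply_of_ne_of_ne hki hkj]
    · rintro (rfl | rfl) k
      · rfl
      · by_cases hki : k = i
        · rw [hki, Equiv.swap_apply_left, hi, hj]
        by_cases hkj : k = j
        · rw [hkj, Equiv.swap_apply_right, hi, hj]
        rw [Equiv.swap_apply_of_ne_of_ne hki hkj]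
  have hne : (1 : Equiv.Perm (Fin n)) ≠ Equiv.swap i j := fun h =>
    hij (Equiv.swap_eq_one_iff.1 h.symm)
  have hrow'' : (fun k => (T ((Equiv.swap i j)⁻¹ k)).1.1) = Pi.single j 1 := by
    funext k
    rw [Equiv.swap_inv]
    refine (congrFun hrow' _).trans ?_
    simp only [Pi.single_apply, Equiv.swap_apply_eq_iff, Equiv.swap_apply_left]
  rw [polytabloid, hfilter, Finset.sum_pair hne, hrow'', map_sub, rowEmbedding_single,
    rowEmbedding_single, Equiv.Perm.sign_swap hij]
  simp [hrow', sub_eq_add_neg]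

theorem exists_hookTableau {n : ℕ} (hn : 2 ≤ n) {i j : Fin n} (hij : i ≠ j) :
    ∃ T : Fin n ≃ (hookShape n hn).cells, (T i).1 = (1, 0) ∧ (T j).1 = (0, 0) := by
  have T₀ : Fin n ≃ (hookShape n hn).cells :=
    ((hookShape n hn).cells.equivFinOfCardEq (card_hookShape n hn)).symm
  let p : (hookShape n hn).cells := ⟨(1, 0), mem_hookShape.2 (Or.inr rfl)⟩
  let q : (hookShape n hn).cells := ⟨(0, 0), mem_hookShape.2 (Or.inl ⟨rfl, by simp; omega⟩)⟩
  have hpq : p ≠ q := fun h => by simpa [p, q] using congrArg (fun c => c.1.1) h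
  -- An arbitrary tableau is corrected by two swaps; the second one does not disturb i.
  let T₁ := (Equiv.swap i (T₀.symm p)).trans T₀
  have h1 : T₁ i = p := by simp [T₁]
  let T₂ := (Equiv.swap j (T₁.symm q)).trans T₁
  have h2 : T₂ j = q := by simp [T₂]
  have h3 : T₂ i = p := by
    have hne : i ≠ T₁.symm q := fun h => hpq (by rw [← h1, h, T₁.apply_symm_apply])
    simp only [T₂, Equiv.trans_apply]
    rw [Equiv.swap_apply_of_ne_of_ne hij hne, h1]
  exact ⟨T₂, by rw [h3], by rw [h2]⟩

theorem specht_hookShape {n : ℕ} (hn : 2 ≤ n) :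
    specht F n (hookShape n hn) = (LinearMap.ker (entrySum F n)).map (rowEmbedding F n) := by
  have hmem : ∀ i j : Fin n, rowEmbedding F n (Pi.single i 1 - Pi.single j 1) ∈
      specht F n (hookShape n hn) := by
    intro i j
    by_cases hij : i = j
    · rw [hij, sub_self, map_zero]; exact zero_mem _
    · obtain ⟨T, hi, hj⟩ := exists_hookTableau hn hij
      rw [← polytabloid_hookShape F hn T hi hj]
      exact Submodule.subset_span ⟨T, rfl⟩
  refine le_antisymm (Submodule.span_le.2 ?_) ?_
  · rintro _ ⟨T, rfl⟩
    obtain ⟨i, hi⟩ := T.surjective ⟨(1, 0), mem_hookShape.2 (Or.inr rfl)⟩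
    obtain ⟨j, hj⟩ := T.surjective ⟨(0, 0), mem_hookShape.2 (Or.inl ⟨rfl, by simp; omega⟩)⟩
    change polytabloid F T ∈ _
    rw [polytabloid_hookShape F hn T (by rw [hi]) (by rw [hj])]
    exact Submodule.mem_map_of_mem (by simp [entrySum_apply])
  · rintro _ ⟨x, hx, rfl⟩
    let i₀ : Fin n := ⟨0, by omega⟩
    have hx' : ∑ i, x i = 0 := by rw [← entrySum_apply]; exact hx
    -- The differences of unit vectors span the vectors of sum zero: the multiples of the unit
    -- vector at i₀ cancel because the entries of x add up to 0.
    have : x = ∑ i, x i • (Pi.single i 1 - Pi.single i₀ 1 : Fin n → F) := by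
      simp only [smul_sub, Finset.sum_sub_distrib, ← Finset.sum_smul, hx', zero_smul, sub_zero]
      exact pi_eq_sum_univ' x
    rw [this, map_sum]
    exact sum_mem fun i _ => by rw [map_smul]; exact Submodule.smul_mem _ _ (hmem i i₀)

/-- The permutation character of `S_n` is `χ_{(n)} + χ_{(n-1,1)}`. -/
theorem trace_funLeft_eq [CharZero F] {n : ℕ} (hn : 2 ≤ n) (σ : Equiv.Perm (Fin n)) :
    LinearMap.trace F (Fin n → F) (LinearMap.funLeft F F ⇑σ⁻¹) =
      1 + chi F n (hookShape n hn) σ := by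
  have hmem : ∀ x ∈ LinearMap.ker (entrySum F n),
      rowEmbedding F n x ∈ specht F n (hookShape n hn) := fun x hx => by
    rw [specht_hookShape]; exact Submodule.mem_map_of_mem hx
  have hn0 : (n : F) ≠ 0 := Nat.cast_ne_zero.2 (by omega)
  have hσ : ∀ x : Fin n → F, entrySum F n (LinearMap.funLeft F F ⇑σ⁻¹ x) = entrySum F n x := by
    intro x
    rw [entrySum_apply, entrySum_apply]
    exact Equiv.sum_comp σ⁻¹ x
  -- Subtracting the mean projects onto the vectors of sum zero. Characteristic zero makes n
  -- invertible, so sum and projection together identify F^n with F ⊕ `specht`, equivariantly.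
  let P : (Fin n → F) →ₗ[F] (Fin n → F) :=
    LinearMap.id - LinearMap.toSpanSingleton F (Fin n → F) (fun _ => (n : F)⁻¹) ∘ₗ entrySum F n
  have hP : ∀ x, P x = x - entrySum F n x • fun _ => (n : F)⁻¹ := fun x => rfl
  have hPker : ∀ x, P x ∈ LinearMap.ker (entrySum F n) := fun x => by
    rw [LinearMap.mem_ker, hP, map_sub, map_smul]
    simp [entrySum_apply, hn0]
  let G : (Fin n → F) →ₗ[F] F × specht F n (hookShape n hn) :=
    (entrySum F n).prod ((rowEmbedding F n ∘ₗ P).codRestrict _ fun x => hmem _ (hPker x))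
  have hG : Function.Bijective G := by
    constructor
    · refine (injective_iff_map_eq_zero G).2 fun x hx => ?_
      have h1 : entrySum F n x = 0 := congrArg Prod.fst hx
      have h2 : rowEmbedding F n (P x) = 0 := congrArg (fun y => (y.2 : (Fin n → ℕ) →₀ F)) hx
      have h3 : P x = 0 := rowEmbedding_injective F n (h2.trans (map_zero _).symm)
      rwa [hP, h1, zero_smul, sub_zero] at h3
    · rintro ⟨s, y, hy⟩
      rw [specht_hookShape] at hy
      obtain ⟨x, hx, rfl⟩ := hy
      have hx0 : entrySum F n x = 0 := hx
      have hs : entrySum F n (x + s • fun _ => (n : F)⁻¹) = s := by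
        rw [map_add, map_smul, hx0]
        simp [entrySum_apply, hn0]
      refine ⟨x + s • fun _ => (n : F)⁻¹, Prod.ext hs (Subtype.ext ?_)⟩
      change rowEmbedding F n (P _) = _
      rw [hP, hs, add_sub_cancel_right]
  let E := LinearEquiv.ofBijective G hG
  have hE : E.conj (LinearMap.funLeft F F ⇑σ⁻¹) = LinearMap.id.prodMap
      (((tabloidRep F n).subrepresentation (specht F n (hookShape n hn))
        (specht_le F (hookShape n hn))) σ) := by
    refine LinearMap.ext fun y => ?_
    obtain ⟨x, rfl⟩ := E.surjective y
    rw [LinearEquiv.conj_apply_apply, E.symm_apply_apply]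
    refine Prod.ext (hσ x) (Subtype.ext ?_)
    change rowEmbedding F n (P _) = tabloidRep F n σ (rowEmbedding F n (P x))
    rw [tabloidRep_rowEmbedding, hP, hP, hσ, map_sub (LinearMap.funLeft F F ⇑σ⁻¹)]
    rfl
  have : Module.Finite F (specht F n (hookShape n hn)) :=
    Module.Finite.of_surjective (LinearMap.snd F F _ ∘ₗ E.toLinearMap)
      (Prod.snd_surjective.comp E.surjective)
  have : Module.Free F (specht F n (hookShape n hn)) :=
    Module.Free.of_divisionRing F (specht F n (hookShape n hn))
  have h1 := LinearMap.trace_conj' (N := F × specht F n (hookShape n hn))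
    (LinearMap.funLeft F F ⇑σ⁻¹) E
  have h2 := LinearMap.trace_prodMap' (N := specht F n (hookShape n hn)) (LinearMap.id (M := F))
    (((tabloidRep F n).subrepresentation (specht F n (hookShape n hn))
        (specht_le F (hookShape n hn))) σ)
  rw [← h1]
  refine (congrArg _ hE).trans (h2.trans ?_)
  rw [LinearMap.trace_id, chi, Representation.character]
  simp

theorem trace_funLeft_one (σ : Equiv.Perm (Fin 1)) :
    LinearMap.trace F (Fin 1 → F) (LinearMap.funLeft F F ⇑σ⁻¹) = 1 := by
  have : LinearMap.funLeft F F ⇑σ⁻¹ = (LinearMap.id : (Fin 1 → F) →ₗ[F] (Fin 1 → F)) := by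
    rw [Subsingleton.elim σ 1]; rfl
  rw [this, LinearMap.trace_id]
  simp

end Shapes

/-! ### Coordinates on `M₁` and `M₂` -/

section Coordinates

variable {F L : Type*} [Field F] [LieRing L] [LieAlgebra F L]

/-- The coordinate `m ↦ m i j` on an algebra of `2 × 2` matrices. -/
def entry (S : NonUnitalSubalgebra F (Matrix (Fin 2) (Fin 2) F)) (i j : Fin 2) : S →ₗ[F] F :=
  Matrix.entryLinearMap F F i j ∘ₗ S.toSubmodule.subtype

theorem entry_apply (S : NonUnitalSubalgebra F (Matrix (Fin 2) (Fin 2) F)) (i j : Fin 2) (m : S) :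
    entry S i j m = m.1 i j := rfl

theorem M₁_mul_right (x y : M₁ F) :
    entry (M₁ F) 0 1 (x * y) = entry (M₁ F) 0 1 x * entry (M₁ F) 1 1 y := by
  obtain ⟨x, hx⟩ := x
  have hx : x 0 0 = 0 ∧ x 1 0 = 0 := hx
  simp [entry_apply, Matrix.mul_apply, hx]

theorem M₂_mul_right (x y : M₂ F) :
    entry (M₂ F) 0 1 (x * y) = entry (M₂ F) 0 0 x * entry (M₂ F) 0 1 y := by
  obtain ⟨y, hy⟩ := y
  have hy : y 1 0 = 0 ∧ y 1 1 = 0 := hy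
  simp [entry_apply, Matrix.mul_apply, hy]

theorem isCoordinates_M₁ {ρ : L →ₗ⁅F⁆ Der F (M₁ F)} {c : L → F} (hρ : ∀ γ, ρ γ = c γ • ε₁ F) :
    IsCoordinates ρ (entry (M₁ F) 1 1) (entry (M₁ F) 0 1) c where
  eq_zero := by
    rintro ⟨x, hx0, hx1⟩ h1 h2
    rw [entry_apply] at h1 h2
    refine Subtype.ext ?_
    ext i j
    fin_cases i <;> fin_cases j <;> assumption
  exists_eq s t := ⟨⟨!![0, t; 0, s], by simp, by simp⟩, by simp [entry_apply], by simp [entry_apply]⟩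
  mul := by
    rintro ⟨x, hx⟩ y
    have hx : x 0 0 = 0 ∧ x 1 0 = 0 := hx
    simp [entry_apply, Matrix.mul_apply, hx]
  act_left γ x := by
    rw [hρ]
    change c γ • Matrix.single (0 : Fin 2) (1 : Fin 2) (x.1 0 1) 1 1 = 0
    simp
  act_right γ x := by
    rw [hρ]
    change c γ • Matrix.single (0 : Fin 2) (1 : Fin 2) (x.1 0 1) 0 1 = c γ * x.1 0 1
    simp

theorem isCoordinates_M₂ {ρ : L →ₗ⁅F⁆ Der F (M₂ F)} {c : L → F} (hρ : ∀ γ, ρ γ = c γ • ε₂ F) :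
    IsCoordinates ρ (entry (M₂ F) 0 0) (entry (M₂ F) 0 1) c where
  eq_zero := by
    rintro ⟨x, hx0, hx1⟩ h1 h2
    rw [entry_apply] at h1 h2
    refine Subtype.ext ?_
    ext i j
    fin_cases i <;> fin_cases j <;> assumption
  exists_eq s t := ⟨⟨!![s, t; 0, 0], by simp, by simp⟩, by simp [entry_apply], by simp [entry_apply]⟩
  mul := by
    rintro x ⟨y, hy⟩
    have hy : y 1 0 = 0 ∧ y 1 1 = 0 := hy
    simp [entry_apply, Matrix.mul_apply, hy]
  act_left γ x := by
    rw [hρ]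
    change c γ • Matrix.single (0 : Fin 2) (1 : Fin 2) (x.1 0 1) 0 0 = 0
    simp
  act_right γ x := by
    rw [hρ]
    change c γ • Matrix.single (0 : Fin 2) (1 : Fin 2) (x.1 0 1) 0 1 = c γ * x.1 0 1
    simp

theorem exists_eq_smul {A : Type*} [NonUnitalRing A] [Module F A] [IsScalarTower F A A]
    [SMulCommClass F A A] {ρ : L →ₗ⁅F⁆ Der F A} {ε : Der F A}
    (hρ : ρ.range.toSubmodule = Submodule.span F {ε}) (γ : L) : ∃ c : F, ρ γ = c • ε := by
  have : ρ γ ∈ ρ.range.toSubmodule := ⟨γ, rfl⟩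
  rw [hρ, Submodule.mem_span_singleton] at this
  exact this.imp fun _ h => h.symm

end Coordinates

/-- When `L` acts faithfully, the trivial identities `x^γ` may be omitted. -/
theorem TSpan_union_of_injective {F L I A : Type*} [Field F] [LieRing L] [LieAlgebra F L]
    (b : Basis I F (UniversalEnvelopingAlgebra F L)) [NonUnitalRing A] [Module F A]
    [IsScalarTower F A A] [SMulCommClass F A A] {ρ : L →ₗ⁅F⁆ Der F A}
    (hρ : Function.Injective ρ) (S : Set (DiffPoly F I)) :
    TSpan b (S ∪ {f | ∃ γ : L, ρ γ = 0 ∧ f = X b 0 (UniversalEnvelopingAlgebra.ι F γ)}) =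
      TSpan b S := by
  refine le_antisymm (TSpan_le b (isTIdeal_TSpan b S) (Set.union_subset (subset_TSpan b S) ?_))
    (TSpan_le b (isTIdeal_TSpan b _) (Set.subset_union_left.trans (subset_TSpan b _)))
  rintro _ ⟨γ, hγ, rfl⟩
  have : γ = 0 := hρ (hγ.trans (map_zero ρ).symm)
  rw [this, map_zero, map_zero]
  exact zero_mem _

end DiffId

/-! ### Assembly of the theorem -/

open DiffId
theorem mainTheorem4 {F L I : Type*} [Field F] [CharZero F] [LieRing L] [LieAlgebra F L]
    (b : Basis I F (UniversalEnvelopingAlgebra F L))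
    (ρ₁ : L →ₗ⁅F⁆ Der F (M₁ F)) (hρ₁ : ρ₁.range.toSubmodule = Submodule.span F {ε₁ F})
    (e₁ : L) (he₁ : ρ₁ e₁ = ε₁ F)
    (ρ₂ : L →ₗ⁅F⁆ Der F (M₂ F)) (hρ₂ : ρ₂.range.toSubmodule = Submodule.span F {ε₂ F})
    (e₂ : L) (he₂ : ρ₂ e₂ = ε₂ F) :
    -- the identities when `L` acts as the one-dimensional Lie algebra spanned by `ε`, faithfully
    ((Function.Injective ρ₁ → IdL b ρ₁ = TSpan b (gens₁ b e₁)) ∧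
      (Function.Injective ρ₂ → IdL b ρ₂ = TSpan b (gens₂ b e₂))) ∧
    -- the identities in general, including the trivial ones `x^γ` for `γ` acting as zero
    (IdL b ρ₁ = TSpan b (gens₁ b e₁ ∪
        {f | ∃ γ : L, ρ₁ γ = 0 ∧ f = X b 0 (UniversalEnvelopingAlgebra.ι F γ)}) ∧
      IdL b ρ₂ = TSpan b (gens₂ b e₂ ∪
        {f | ∃ γ : L, ρ₂ γ = 0 ∧ f = X b 0 (UniversalEnvelopingAlgebra.ι F γ)})) ∧
    -- the codimensions
    (∀ n : ℕ, 1 ≤ n → codim b ρ₁ n = ((n + 1 : ℕ) : Cardinal) ∧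
      codim b ρ₂ n = ((n + 1 : ℕ) : Cardinal)) ∧
    -- the cocharacters; for `n = 1` there is no partition `(n - 1, 1)`
    (cochar b ρ₁ 1 = 2 • chi F 1 (rowShape 1) ∧ cochar b ρ₂ 1 = 2 • chi F 1 (rowShape 1)) ∧
    (∀ (n : ℕ) (hn : 2 ≤ n),
      cochar b ρ₁ n = 2 • chi F n (rowShape n) + chi F n (hookShape n hn) ∧
      cochar b ρ₂ n = 2 • chi F n (rowShape n) + chi F n (hookShape n hn)) := by
  choose c₁ hc₁ using exists_eq_smul hρ₁
  choose c₂ hc₂ using exists_eq_smul hρ₂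
  have H₁ := isCoordinates_M₁ hc₁
  have H₂ := isCoordinates_M₂ hc₂
  -- The scalar is read off from the β-coordinate of ε applied to an element with β = 1.
  have hε₁ : c₁ e₁ = 1 := by
    obtain ⟨x, -, hx⟩ := H₁.exists_eq 0 1
    have h := H₁.act_right e₁ x
    rw [hx, mul_one, he₁] at h
    rw [← h, ← hx]
    exact Matrix.single_apply_same (0 : Fin 2) (1 : Fin 2) (x.1 0 1)
  have hε₂ : c₂ e₂ = 1 := by
    obtain ⟨x, -, hx⟩ := H₂.exists_eq 0 1
    have h := H₂.act_right e₂ x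
    rw [hx, mul_one, he₂] at h
    rw [← h, ← hx]
    exact Matrix.single_apply_same (0 : Fin 2) (1 : Fin 2) (x.1 0 1)
  have hid₁ := IdL_eq_TSpan₁ (b := b) H₁ M₁_mul_right hε₁ fun γ => by rw [hc₁ γ, he₁]
  have hid₂ := IdL_eq_TSpan₂ (b := b) H₂ M₂_mul_right hε₂ fun γ => by rw [hc₂ γ, he₂]
  obtain ⟨χ₁, ψ₁, hχ₁, hψ₁, hχ1₁, hψ1₁, hι₁⟩ := H₁.exists_weights
  obtain ⟨χ₂, ψ₂, hχ₂, hψ₂, hχ1₂, hψ1₂, hι₂⟩ := H₂.exists_weights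
  have hw₁ := wordsEvalAt_zero (b := b) H₁.mul hχ₁ hψ₁ M₁_mul_right
  have hw₂ := wordsEvalAt_last (b := b) H₂.mul hχ₂ hψ₂ M₂_mul_right
  refine ⟨⟨fun h => hid₁.trans (TSpan_union_of_injective b h _),
    fun h => hid₂.trans (TSpan_union_of_injective b h _)⟩, ⟨hid₁, hid₂⟩, fun n hn => ?_,
    ⟨funext fun σ => ?_, funext fun σ => ?_⟩, fun n hn => ?_⟩
  -- Writing n as m + 1 supplies the first or last position that carries β.
  · obtain ⟨m, rfl⟩ := Nat.exists_eq_add_of_le' hn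
    exact ⟨codim_eq H₁ hε₁ (hw₁ m) hχ1₁ hψ1₁ hι₁, codim_eq H₂ hε₂ (hw₂ m) hχ1₂ hψ1₂ hι₂⟩
  -- For n = 1 the permutation module is itself trivial, so both summands contribute the trivial
  -- character.
  · rw [cochar_eq H₁ hε₁ (hw₁ 0) hχ1₁ hψ1₁ hι₁, trace_funLeft_one, Pi.smul_apply, chi_rowShape]
    norm_num
  · rw [cochar_eq H₂ hε₂ (hw₂ 0) hχ1₂ hψ1₂ hι₂, trace_funLeft_one, Pi.smul_apply, chi_rowShape]
    norm_num
  · obtain ⟨m, rfl⟩ := Nat.exists_eq_add_of_le' (one_le_two.trans hn)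
    refine ⟨funext fun σ => ?_, funext fun σ => ?_⟩
    · rw [cochar_eq H₁ hε₁ (hw₁ m) hχ1₁ hψ1₁ hι₁, trace_funLeft_eq F hn, Pi.add_apply,
        Pi.smul_apply, chi_rowShape]
      ring
    · rw [cochar_eq H₂ hε₂ (hw₂ m) hχ1₂ hψ1₂ hι₂, trace_funLeft_eq F hn, Pi.add_apply,
        Pi.smul_apply, chi_rowShape]
      ring
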